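/- For integer vectors $u_1,\dots,u_4\in\mathbb Z^3$ any three of which are linearly independent, let $v_i$ be the absolute value of the determinant of the three vectors other than $u_i$. If $v_1,\dots,v_4$ are pairwise distinct, then for any $c\in\mathbb R^3$ the zonotope $Z=\{c+\sum_{i=1}^4\lambda_iu_i:\lambda_i\in[0,1]\}$ is called a strong Lonely Runner $3$-zonotope (sLR $3$-zonotope) with volume vector $(v_1,v_2,v_3,v_4)$. The covering radius $\mu(Z)$ is the smallest $\rho>0$ such that $\rho Z+\mathbb Z^3=\mathbb R^3$. **Theorem 4.1.** There are exactly $2\,133\,561$ vectors $(v_1,v_2,v_3,v_4)\in\mathbb Z^4$ with $1\le v_1<v_2<v_3<v_4$, $\gcd(v_1,v_2,v_3,v_4)=1$ and $v_1+v_2+v_3+v_4\le195$. Each of them is the volume vector of an sLR $3$-zonotope, and two sLR $3$-zonotopes with such volume vectors $v$ and $v'$ are equivalent under a map $x\mapsto Ax+t$ with $A\in\operatorname{GL}(3,\mathbb Z)$ and $t\in\mathbb R^3$ if and only if $v=v'$; thus there are exactly $2\,133\,561$ such zonotopes up to this equivalence. Every sLR $3$-zonotope $Z$ whose volume vector is one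 of these vectors has a covering radius (the smallest $\rho$ above exists), and $\mu(Z)\le\frac35$. -/

import Mathlib

open scoped Pointwise

namespace LonelyRunner

/-- The zonotope `c + ∑ i, [0, u i]` in `ℝ^d` with generators `u i`. -/
def zonotope {d n : ℕ} (c : Fin d → ℝ) (u : Fin n → Fin d → ℝ) : Set (Fin d → ℝ) :=
  {x | ∃ l : Fin n → ℝ, (∀ i, l i ∈ Set.Icc (0 : ℝ) 1) ∧ x = c + ∑ i, l i • u i}

/-- An integer vector, seen in `ℝ^d`. -/
def toReal {d : ℕ} (z : Fin d → ℤ) : Fin d → ℝ := fun i => (z i : ℝ)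

/-- Linear general position of `d + 1` integer vectors in `ℝ^d`: any `d` of them are linearly
independent, hence a basis of `ℝ^d`. -/
def GeneralPosition {d : ℕ} (U : Fin (d + 1) → Fin d → ℤ) : Prop :=
  ∀ i : Fin (d + 1), LinearIndependent ℝ fun j : Fin d => toReal (U (i.succAbove j))

/-- The volume vector of `d + 1` integer vectors in `ℝ^d`: its entry at `i` is the absolute value
of the determinant of the `d` vectors other than the one with index `i`. -/
def volumeVector {d : ℕ} (U : Fin (d + 1) → Fin d → ℤ) : Fin (d + 1) → ℤ :=
  fun i => |(Matrix.of fun j : Fin d => U (i.succAbove j)).det|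

/-- `Z` is a strong Lonely Runner `d`-zonotope with volume vector `v`: a zonotope in `ℝ^d`
generated by `d + 1` integer vectors in linear general position, whose volume vector `v` has
pairwise distinct entries. The base point `c` is arbitrary. -/
def IsSLRZonotope {d : ℕ} (Z : Set (Fin d → ℝ)) (v : Fin (d + 1) → ℤ) : Prop :=
  ∃ U : Fin (d + 1) → Fin d → ℤ, GeneralPosition U ∧ volumeVector U = v ∧
    Function.Injective v ∧ ∃ c : Fin d → ℝ, Z = zonotope c fun i => toReal (U i)

/-- `Z'` is the image of `Z` under a map `x ↦ A x + t`, where `A` is an integer matrix of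
determinant `±1` and `t` is a translation vector. -/
def UnimodularEquiv {d : ℕ} (Z Z' : Set (Fin d → ℝ)) : Prop :=
  ∃ (A : Matrix (Fin d) (Fin d) ℤ) (t : Fin d → ℝ), (A.det = 1 ∨ A.det = -1) ∧
    Z' = (fun x => (A.map (Int.cast : ℤ → ℝ)).mulVec x + t) '' Z

/-- The integer lattice `ℤ^d` in `ℝ^d`. -/
def integerLattice (d : ℕ) : Set (Fin d → ℝ) :=
  Set.range (toReal : (Fin d → ℤ) → Fin d → ℝ)

/-- The dilation factors `ρ > 0` with `ρ C + ℤ^d = ℝ^d`. -/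
def coveringDilations {d : ℕ} (C : Set (Fin d → ℝ)) : Set ℝ :=
  {ρ | 0 < ρ ∧ ρ • C + integerLattice d = Set.univ}

/-- The covering radius of `C`: the infimum of the covering dilation factors; for a convex body
with nonempty interior it is the smallest of them. -/
noncomputable def coveringRadius {d : ℕ} (C : Set (Fin d → ℝ)) : ℝ :=
  sInf (coveringDilations C)

/-- The primitive, strictly increasing vectors of four positive integers with sum at most `195`. -/
def volumeVectors195 : Set (Fin 4 → ℤ) :=
  {v | 1 ≤ v 0 ∧ v 0 < v 1 ∧ v 1 < v 2 ∧ v 2 < v 3 ∧ Finset.univ.gcd v = 1 ∧ ∑ i, v i ≤ 195}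

end LonelyRunner

/-! By Cramer's rule the four generators satisfy a linear relation with coefficients `±v i`. Writing
points of `ℝ^3` as combinations of the generators, a coefficient vector in `ℝ^4` may be moved along
the line of this relation without changing the point, and by integer vectors at the cost of a
lattice point. So `3/5 • Z` covers modulo `ℤ^3` once every line of direction `v` in `ℝ^4` meets an
integer translate of a cube of side `3/5`. This is `MeetsCube v`, a lonely runner statement with
arbitrary starting points; `MeetsCube.mem_coveringDilations` makes the passage, and compactness
shows that the infimum is attained.

`MeetsCube` is certified by computation in two ways. `MeetsCube.of_box` reduces modulo `v` and two
integer vectors `w`, `u`: a box in the remaining direction absorbs the last coordinate, and rounding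
handles the other two. One form of this certificate stays valid when the fastest runner speeds up,
so one evaluation settles infinitely many vectors. What is left goes to `noCover_spec`: if the
property failed, the time intervals in which some runner is farther than `3/10` from the integers
would cover the line, and a search through chains of overlapping intervals, pruned by difference
constraints, excludes this.

For the classification, a primitive volume vector forces the generators to span `ℤ^3`, so families
with the same vector differ by a unimodular map and signs (`exists_matrix`), and sign changes only
translate a zonotope. Conversely the width function `f ↦ ∑ |f (u i)|` determines the generators up
to order and sign (`exists_eq_or_neg_of_sum_abs_eq`), hence their relation up to scale; ordering and
primitivity then fix the vector. Existence is an explicit Bézout construction, and the count is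
evaluated directly. -/

namespace LonelyRunner

/-! ### The runner property and the box criterion -/

/-- A shifted Lonely Runner property: the line through `s` in direction `v` meets the union of the
integer translates of the cube `[-3/10, 3/10]^4`. -/
def MeetsCube (v : Fin 4 → ℤ) : Prop :=
  ∀ s : Fin 4 → ℝ, ∃ (t : ℝ) (n : Fin 4 → ℤ), ∀ i, |s i - t * v i - n i| ≤ 3 / 10

theorem MeetsCube.of_perm {v : Fin 4 → ℤ} (σ : Equiv.Perm (Fin 4))
    (h : MeetsCube (v ∘ σ)) : MeetsCube v := by
  intro s
  obtain ⟨t, n, hn⟩ := h (s ∘ σ)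
  refine ⟨t, n ∘ σ.symm, fun i => ?_⟩
  simpa using hn (σ.symm i)

/-- The generalized cross product of three vectors in dimension four. -/
def cross {R : Type*} [CommRing R] (v w u : Fin 4 → R) : Fin 4 → R :=
  ![v 1 * (w 2 * u 3 - w 3 * u 2) - v 2 * (w 1 * u 3 - w 3 * u 1) + v 3 * (w 1 * u 2 - w 2 * u 1),
    -(v 0 * (w 2 * u 3 - w 3 * u 2) - v 2 * (w 0 * u 3 - w 3 * u 0)
      + v 3 * (w 0 * u 2 - w 2 * u 0)),
    v 0 * (w 1 * u 3 - w 3 * u 1) - v 1 * (w 0 * u 3 - w 3 * u 0) + v 3 * (w 0 * u 1 - w 1 * u 0),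
    -(v 0 * (w 1 * u 2 - w 2 * u 1) - v 1 * (w 0 * u 2 - w 2 * u 0)
      + v 2 * (w 0 * u 1 - w 1 * u 0))]

/-- For `i ≠ k` this is Cramer's rule on the three rows other than `k`, a polynomial identity. For
`i = k` it expands the `4 × 4` determinant of `v`, `w`, `u`, `r` along row `k`, which vanishes by
`hr`. -/
theorem cross_mul_eq {v w u r : Fin 4 → ℝ} (hr : ∑ i, cross v w u i * r i = 0) (k i : Fin 4) :
    cross v w u k * r i =
      cross r w u k * v i + cross v r u k * w i + cross v w r k * u i := by
  simp only [Fin.sum_univ_four, cross, Matrix.cons_val] at hr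
  fin_cases k <;> fin_cases i <;>
    simp only [cross, Fin.zero_eta, Fin.mk_one, Fin.reduceFinMk, Matrix.cons_val] <;>
    first | ring1 | linear_combination hr

theorem exists_combination_of_cross {v w u r : Fin 4 → ℝ} (hk : cross v w u ≠ 0)
    (hr : ∑ i, cross v w u i * r i = 0) :
    ∃ α β γ : ℝ, ∀ i, r i = α * v i + β * w i + γ * u i := by
  obtain ⟨k, hk⟩ := Function.ne_iff.1 hk
  rw [Pi.zero_apply] at hk
  refine ⟨cross r w u k / cross v w u k, cross v r u k / cross v w u k,
    cross v w r k / cross v w u k, fun i => ?_⟩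
  have := cross_mul_eq hr k i
  field_simp
  linear_combination this

theorem cross_cast (v w u : Fin 4 → ℤ) (i : Fin 4) :
    cross (fun i => (v i : ℝ)) (fun i => (w i : ℝ)) (fun i => (u i : ℝ)) i = cross v w u i := by
  fin_cases i <;> simp [cross]

theorem abs_sub_round_mul_le (x y : ℝ) : |(x - round x) * y| ≤ |y| / 2 := by
  rw [abs_mul]
  nlinarith [abs_sub_round x, abs_nonneg y]

/-- If the vectors `w - τ₁ v` and `u - τ₂ v - κ w` span a parallelogram in the cube of side `3/5`
that leaves room for a box of sides `h i`, and the projections of this box along the hyperplanes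
spanned by `v`, `w`, `u` cover the quotient of `ℤ^4`, then the line in direction `v` meets every
translate of the periodic cubes. -/
theorem MeetsCube.of_box {v w u : Fin 4 → ℤ} {τ₁ τ₂ κ : ℝ} {h : Fin 4 → ℝ} {g : ℤ} {z : Fin 4 → ℤ}
    (h0 : ∀ i, 0 ≤ h i)
    (hbox : ∀ i, |(w i : ℝ) - τ₁ * v i| + |(u i : ℝ) - τ₂ * v i - κ * w i| + h i ≤ 3 / 5)
    (hg : 0 < g) (hz : ∑ i, cross v w u i * z i = g)
    (hS : (g : ℝ) ≤ ∑ i, |((cross v w u i : ℤ) : ℝ)| * h i) : MeetsCube v := by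
  intro s
  have hg' : (0 : ℝ) < g := by exact_mod_cast hg
  set m : Fin 4 → ℝ := fun i => ((cross v w u i : ℤ) : ℝ) with hm
  set S : ℝ := ∑ i, |m i| * h i with hSdef
  have hSpos : 0 < S := hg'.trans_le hS
  have hmz : ∑ i, m i * z i = g := by rw [← hz]; push_cast; rfl
  -- Modulo `v`, `w`, `u` only the value of the functional `m` matters, and `m z = g`. Subtracting
  -- `n₀ z` leaves a value `y` of size at most `g / 2 ≤ S / 2`.
  set n₀ : ℤ := round ((∑ i, m i * s i) / g)
  set y : ℝ := (∑ i, m i * s i) - g * n₀ with hy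
  have hyS : |y / S| ≤ 1 / 2 := by
    have h1 : |(∑ i, m i * s i) / g - n₀| ≤ 1 / 2 := abs_sub_round _
    have h2 : y = g * ((∑ i, m i * s i) / g - n₀) := by rw [hy]; field_simp
    rw [abs_div, abs_of_pos hSpos, div_le_iff₀ hSpos, h2, abs_mul, abs_of_pos hg']
    nlinarith [abs_nonneg ((∑ i, m i * s i) / g - n₀)]
  -- The functional `m` maps the box with sides `h i` centred at `0` onto `[-S/2, S/2]`; `p` is the
  -- point over `y` on the diagonal along which `m` is largest.
  set p : Fin 4 → ℝ := fun i => y / S * (SignType.sign (m i) * h i) with hp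
  have hpabs : ∀ i, |p i| ≤ h i / 2 := by
    intro i
    have h1 : |((SignType.sign (m i) : SignType) : ℝ)| ≤ 1 := by
      rcases lt_trichotomy (m i) 0 with hi | hi | hi <;> simp [hi]
    rw [hp]
    simp only
    rw [abs_mul, abs_mul, abs_of_nonneg (h0 i)]
    have h2 : |((SignType.sign (m i) : SignType) : ℝ)| * h i ≤ h i := by nlinarith [h0 i]
    have h3 := h0 i
    have h4 : 0 ≤ |((SignType.sign (m i) : SignType) : ℝ)| * h i := by positivity
    nlinarith [abs_nonneg (y / S)]
  have hmp : ∑ i, m i * p i = y := by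
    have : ∀ i, m i * p i = y / S * (|m i| * h i) := by
      intro i
      rw [hp]
      simp only
      rw [← self_mul_sign (m i)]
      ring
    rw [Finset.sum_congr rfl fun i _ => this i, ← Finset.mul_sum, ← hSdef]
    field_simp
  have hmeq : cross (fun i => (v i : ℝ)) (fun i => (w i : ℝ)) (fun i => (u i : ℝ)) = m :=
    funext fun i => cross_cast v w u i
  obtain ⟨α, β, γ, hc⟩ := exists_combination_of_cross (v := fun i => (v i : ℝ))
    (w := fun i => (w i : ℝ)) (u := fun i => (u i : ℝ)) (r := fun i => s i - n₀ * z i - p i)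
    (by
      rw [hmeq]
      intro h0
      rw [h0] at hmz
      simp only [Pi.zero_apply, zero_mul, Finset.sum_const_zero] at hmz
      exact hg'.ne hmz)
    (by
      rw [hmeq]
      have : ∀ i, m i * (s i - n₀ * z i - p i) = m i * s i - n₀ * (m i * z i) - m i * p i :=
        fun i => by ring
      rw [Finset.sum_congr rfl fun i _ => this i, Finset.sum_sub_distrib, Finset.sum_sub_distrib,
        ← Finset.mul_sum, hmp, hmz, hy]
      ring)
  set n₂ : ℤ := round γ
  -- Replacing `u` by `u - τ₂ v - κ w` in the fractional part `γ - n₂` moves `(γ - n₂) κ` into the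
  -- coefficient of `w`, which therefore has to be rounded second.
  set β' : ℝ := β + (γ - n₂) * κ
  set n₁ : ℤ := round β'
  refine ⟨α + (γ - n₂) * τ₂ + (β' - n₁) * τ₁, fun i => n₀ * z i + n₂ * u i + n₁ * w i, fun i => ?_⟩
  have hci := hc i
  have key : s i - (α + (γ - n₂) * τ₂ + (β' - n₁) * τ₁) * v i -
      ((n₀ * z i + n₂ * u i + n₁ * w i : ℤ) : ℝ) =
      p i + (γ - n₂) * ((u i : ℝ) - τ₂ * v i - κ * w i) + (β' - n₁) * ((w i : ℝ) - τ₁ * v i) := by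
    push_cast
    have hβ : β = β' - (γ - n₂) * κ := by simp only [β']; ring
    rw [hβ] at hci
    linear_combination hci
  rw [key]
  have h1 := abs_sub_round_mul_le γ ((u i : ℝ) - τ₂ * v i - κ * w i)
  have h2 := abs_sub_round_mul_le β' ((w i : ℝ) - τ₁ * v i)
  have h3 := hpabs i
  have h4 := hbox i
  refine (abs_add_three _ _ _).trans ?_
  linarith

/-! ### The box test in natural numbers -/

/-- `|x - y|` for natural numbers. -/
def absDiff (x y : ℕ) : ℕ := (x - y) + (y - x)

/-- The box test for the runners `a`, `b`, `c`, `d` with the steps `(0, 0, 0, 1)` at time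
`2 / (5 d)` and `(p, q, r, 0)` at time `T / (5 d x)`. -/
def boxTest (a b c d p q r x T : ℕ) : Bool :=
  (absDiff (5 * d * x * p) (a * T)).ble (x * (3 * d - 2 * a)) &&
  ((absDiff (5 * d * x * q) (b * T)).ble (x * (3 * d - 2 * b)) &&
  ((absDiff (5 * d * x * r) (c * T)).ble (x * (3 * d - 2 * c)) &&
  (Nat.ble 1 (absDiff (b * r) (c * q) + absDiff (c * p) (a * r)) &&
   (5 * d * x * Nat.gcd (absDiff (b * r) (c * q))
      (Nat.gcd (absDiff (c * p) (a * r)) (absDiff (a * q) (b * p)))).ble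
     (absDiff (b * r) (c * q) * (x * (3 * d - 2 * a) - absDiff (5 * d * x * p) (a * T)) +
      absDiff (c * p) (a * r) * (x * (3 * d - 2 * b) - absDiff (5 * d * x * q) (b * T)) +
      absDiff (a * q) (b * p) * (x * (3 * d - 2 * c) - absDiff (5 * d * x * r) (c * T))))))

theorem cast_absDiff {R : Type*} [Ring R] [LinearOrder R] [IsStrictOrderedRing R] (x y : ℕ) :
    ((absDiff x y : ℕ) : R) = |(x : R) - y| := by
  unfold absDiff
  rcases le_total x y with h | h
  · rw [Nat.sub_eq_zero_of_le h, zero_add, Nat.cast_sub h, abs_sub_comm, abs_of_nonneg]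
    exact sub_nonneg.2 (by exact_mod_cast h)
  · rw [Nat.sub_eq_zero_of_le h, add_zero, Nat.cast_sub h, abs_of_nonneg]
    exact sub_nonneg.2 (by exact_mod_cast h)

theorem exists_bezout_three (x y z : ℤ) :
    ∃ X Y Z : ℤ, x * X + y * Y + z * Z =
      (Nat.gcd x.natAbs (Nat.gcd y.natAbs z.natAbs) : ℤ) := by
  refine ⟨Int.gcdA x (Int.gcd y z), Int.gcdB x (Int.gcd y z) * Int.gcdA y z,
    Int.gcdB x (Int.gcd y z) * Int.gcdB y z, ?_⟩
  have h1 := Int.gcd_eq_gcd_ab x (Int.gcd y z)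
  have h2 := Int.gcd_eq_gcd_ab y z
  have h3 : ((Nat.gcd x.natAbs (Nat.gcd y.natAbs z.natAbs) : ℕ) : ℤ) =
      Int.gcd x (Int.gcd y z) := by
    simp [Int.gcd]
  rw [h3, h1]
  nth_rewrite 5 [h2]
  ring

/-- Three-runner form of `MeetsCube.of_box`; the condition is monotone in the speed `d` of the
fourth runner, which is at position `2 / 5` at the first step. -/
theorem MeetsCube.of_triple {a b c d : ℕ} (hd : 0 < d) {p q r : ℕ} {τ : ℝ} {h₀ h₁ h₂ : ℝ}
    (h0 : 0 ≤ h₀) (h1 : 0 ≤ h₁) (h2 : 0 ≤ h₂)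
    (k0 : 2 * a / (5 * d) + |(p : ℝ) - τ * a| + h₀ ≤ 3 / 5)
    (k1 : 2 * b / (5 * d) + |(q : ℝ) - τ * b| + h₁ ≤ 3 / 5)
    (k2 : 2 * c / (5 * d) + |(r : ℝ) - τ * c| + h₂ ≤ 3 / 5)
    (hm : 1 ≤ absDiff (b * r) (c * q) + absDiff (c * p) (a * r))
    (hS : (Nat.gcd (absDiff (b * r) (c * q))
      (Nat.gcd (absDiff (c * p) (a * r)) (absDiff (a * q) (b * p))) : ℝ) ≤
      absDiff (b * r) (c * q) * h₀ + absDiff (c * p) (a * r) * h₁ + absDiff (a * q) (b * p) * h₂) :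
    MeetsCube ![(a : ℤ), b, c, d] := by
  have natAbs_eq : ∀ x y : ℕ, (absDiff x y) = ((x : ℤ) - y).natAbs := fun x y => by
    zify
    exact cast_absDiff x y
  obtain ⟨X, Y, Z, hXYZ⟩ := exists_bezout_three ((b * r : ℕ) - (c * q : ℕ) : ℤ)
    ((c * p : ℕ) - (a * r : ℕ) : ℤ) ((a * q : ℕ) - (b * p : ℕ) : ℤ)
  simp only [← natAbs_eq] at hXYZ
  have hd' : (0 : ℝ) < d := by exact_mod_cast hd
  -- With `τ₁ = 2 / (5 d)` the first step equals `3/5` in the fourth coordinate and fills the cube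
  -- there; `κ = -τ d` makes the second step vanish there. Hence the fourth side of the box is `0`
  -- and only minors of `(a, b, c)` and `(p, q, r)` enter.
  refine MeetsCube.of_box (w := ![0, 0, 0, 1]) (u := ![p, q, r, 0]) (τ₁ := 2 / (5 * d)) (τ₂ := τ)
    (κ := -τ * d) (h := ![h₀, h₁, h₂, 0])
    (g := (Nat.gcd (absDiff (b * r) (c * q))
      (Nat.gcd (absDiff (c * p) (a * r)) (absDiff (a * q) (b * p))) : ℕ)) (z := ![-X, -Y, -Z, 0])
    ?_ ?_ ?_ ?_ ?_
  · intro i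
    fin_cases i <;> simp [h0, h1, h2]
  · have e : ∀ x : ℕ, |(0 : ℝ) - 2 / (5 * d) * x| = 2 * x / (5 * d) := fun x => by
      rw [zero_sub, abs_neg, abs_of_nonneg (by positivity)]
      ring
    intro i
    fin_cases i
    · simpa [← e] using k0
    · simpa [← e] using k1
    · simpa [← e] using k2
    · have : (1 : ℝ) - 2 / (5 * d) * d = 3 / 5 := by field_simp; norm_num
      simp [this]
      norm_num
  · rw [Nat.cast_pos]
    refine Nat.pos_of_ne_zero fun h => ?_
    rw [Nat.gcd_eq_zero_iff, Nat.gcd_eq_zero_iff] at h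
    omega
  · rw [← hXYZ]
    simp [Fin.sum_univ_four, cross]
    ring
  · have f0 : |((cross ![(a : ℤ), b, c, d] ![0, 0, 0, 1] ![(p : ℤ), q, r, 0] 0 : ℤ) : ℝ)| =
        absDiff (b * r) (c * q) := by
      rw [cast_absDiff, abs_sub_comm]
      simp [cross]
      congr 1
      ring
    have f1 : |((cross ![(a : ℤ), b, c, d] ![0, 0, 0, 1] ![(p : ℤ), q, r, 0] 1 : ℤ) : ℝ)| =
        absDiff (c * p) (a * r) := by
      rw [cast_absDiff, abs_sub_comm]
      simp [cross]
      congr 1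
      ring
    have f2 : |((cross ![(a : ℤ), b, c, d] ![0, 0, 0, 1] ![(p : ℤ), q, r, 0] 2 : ℤ) : ℝ)| =
        absDiff (a * q) (b * p) := by
      rw [cast_absDiff, abs_sub_comm]
      simp [cross]
      congr 1
      ring
    rw [Fin.sum_univ_four, f0, f1, f2]
    simpa using hS

/-- The test is the hypothesis of `MeetsCube.of_triple` scaled by `5 d x`; its inequalities keep all
truncated subtractions exact. Passing from `d` to `d' ≥ d` with the same time `τ` only shrinks the
terms `2 y / (5 d)` and leaves the minors alone. -/
theorem MeetsCube.of_boxTest {a b c d d' p q r x T : ℕ} (hx : 0 < x) (hd : 0 < d) (hdd : d ≤ d')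
    (ha : 2 * a ≤ 3 * d) (hb : 2 * b ≤ 3 * d) (hc : 2 * c ≤ 3 * d)
    (h : boxTest a b c d p q r x T = true) : MeetsCube ![(a : ℤ), b, c, d'] := by
  simp only [boxTest, Bool.and_eq_true, Nat.ble_eq] at h
  obtain ⟨h0, h1, h2, hm, hS⟩ := h
  have hx' : (0 : ℝ) < x := by exact_mod_cast hx
  have hd' : (0 : ℝ) < d := by exact_mod_cast hd
  have hdd' : (d : ℝ) ≤ d' := by exact_mod_cast hdd
  have hE : (0 : ℝ) < 5 * d * x := by positivity
  have key : ∀ y o : ℕ, 2 * y ≤ 3 * d → absDiff (5 * d * x * o) (y * T) ≤ x * (3 * d - 2 * y) →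
      0 ≤ ((x * (3 * d - 2 * y) - absDiff (5 * d * x * o) (y * T) : ℕ) : ℝ) / (5 * d * x) ∧
      2 * y / (5 * d') + |(o : ℝ) - (T / (5 * d * x) : ℝ) * y| +
        ((x * (3 * d - 2 * y) - absDiff (5 * d * x * o) (y * T) : ℕ) : ℝ) / (5 * d * x) ≤
          3 / 5 := by
    intro y o hy hyo
    refine ⟨by positivity, ?_⟩
    have e1 : (2 * y / (5 * d') : ℝ) ≤ 2 * y / (5 * d) := by gcongr
    have e2 : |(o : ℝ) - (T / (5 * d * x) : ℝ) * y| =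
        (absDiff (5 * d * x * o) (y * T) : ℕ) / (5 * d * x) := by
      rw [cast_absDiff]
      have : (o : ℝ) - (T / (5 * d * x) : ℝ) * y =
          (((5 * d * x * o : ℕ) : ℝ) - (y * T : ℕ)) / (5 * d * x) := by
        push_cast
        field_simp
      rw [this, abs_div, abs_of_pos hE]
    rw [e2, Nat.cast_sub hyo, Nat.cast_mul, Nat.cast_sub hy]
    refine (add_le_add_left (add_le_add_left e1 _) _).trans (le_of_eq ?_)
    push_cast
    field_simp
    ring
  refine MeetsCube.of_triple (hd.trans_le hdd) (key a p ha h0).1 (key b q hb h1).1 (key c r hc h2).1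
    (key a p ha h0).2 (key b q hb h1).2 (key c r hc h2).2 hm ?_
  have hS' := (Nat.cast_le (α := ℝ)).2 hS
  rw [← mul_div_assoc, ← mul_div_assoc, ← mul_div_assoc, ← add_div, ← add_div, le_div_iff₀ hE]
  push_cast at hS' ⊢
  linarith

/-! ### Searching for coverings by bad time intervals -/

/-- Conjunction of `f i` for `i < n`. -/
def allBelow (n : ℕ) (f : ℕ → Bool) : Bool := Nat.rec true (fun i r => f i && r) n

theorem allBelow_eq_true {n : ℕ} {f : ℕ → Bool} :
    allBelow n f = true ↔ ∀ i < n, f i = true := by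
  induction n with
  | zero => simp [allBelow]
  | succ n ih =>
    have : allBelow (n + 1) f = (f n && allBelow n f) := rfl
    rw [this, Bool.and_eq_true, ih]
    constructor
    · rintro ⟨h1, h2⟩ i hi
      rcases Nat.lt_succ_iff_lt_or_eq.1 hi with h | rfl
      exacts [h2 i h, h1]
    · exact fun h => ⟨h n (Nat.lt_succ_self n), fun i hi => h i (hi.trans (Nat.lt_succ_self n))⟩

/-- `f n`, written so that the kernel evaluates `n` first. -/
def withNat {α : Type} (n : ℕ) (f : ℕ → α) : α := Nat.rec (f 0) (fun m _ => f (Nat.succ m)) n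

/-- `f z`, written so that the kernel evaluates `z` first. -/
def withInt (z : ℤ) (f : ℤ → Bool) : Bool :=
  Int.casesOn z (fun n => withNat n fun m => f (Int.ofNat m))
    (fun n => withNat n fun m => f (Int.negSucc m))

theorem withNat_eq {α : Type} (n : ℕ) (f : ℕ → α) : withNat n f = f n := by
  cases n <;> rfl

theorem withInt_eq (z : ℤ) (f : ℤ → Bool) : withInt z f = f z := by
  cases z with
  | ofNat n => exact withNat_eq n fun m => f (Int.ofNat m)
  | negSucc n => exact withNat_eq n fun m => f (Int.negSucc m)

def isNonneg (z : ℤ) : Bool := Int.casesOn z (fun _ => true) (fun _ => false)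

theorem isNonneg_eq_true {z : ℤ} : isNonneg z = true ↔ 0 ≤ z := by
  cases z with
  | ofNat n => simp [isNonneg]
  | negSucc n => simp [isNonneg]

/-- The entry `n` of the list `x`, `y`, `z`, `w`. -/
def pick (x y z w : ℤ) (n : ℕ) : ℤ :=
  match n with
  | 0 => x
  | 1 => y
  | 2 => z
  | _ => w

/-- `f D` for a `4 × 4` table `D` with zero diagonal, written so that the kernel evaluates `D`
first. -/
def withTable (D : ℕ → ℕ → ℤ) (f : (ℕ → ℕ → ℤ) → Bool) : Bool :=
  withInt (D 0 1) fun d01 => withInt (D 0 2) fun d02 => withInt (D 0 3) fun d03 =>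
  withInt (D 1 0) fun d10 => withInt (D 1 2) fun d12 => withInt (D 1 3) fun d13 =>
  withInt (D 2 0) fun d20 => withInt (D 2 1) fun d21 => withInt (D 2 3) fun d23 =>
  withInt (D 3 0) fun d30 => withInt (D 3 1) fun d31 => withInt (D 3 2) fun d32 =>
  f fun a b => pick (pick 0 d01 d02 d03 b) (pick d10 0 d12 d13 b) (pick d20 d21 0 d23 b)
    (pick d30 d31 d32 0 b) a

/-- One step of the Floyd-Warshall closure: the bounds `x a - x b < D a b`
after adding `x i - x j < c`. -/
def tighten (D : ℕ → ℕ → ℤ) (i j : ℕ) (c : ℤ) : ℕ → ℕ → ℤ :=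
  fun a b => bif isNonneg (D a i + c + D j b - D a b) then D a b else D a i + c + D j b

/-- Search for a covering of the real line by the open intervals
`(x i + k P i, x i + k P i + W i)`, `i < 4`, `k : ℤ`, subject to the bounds `x a - x b < D a b`,
following the right endpoint `x j + c` of the last interval. The value is `true` if there is
none. -/
def noCover (P W : ℕ → ℤ) (fuel : ℕ) : (ℕ → ℕ → ℤ) → ℕ → ℤ → Bool :=
  Nat.rec (fun _ _ _ => false) (fun _ rec D j c =>
    allBelow 4 fun i => Nat.beq i j ||
      allBelow ((c + D j i) / P i - (c - W i - D i j) / P i + 1).toNat fun m =>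
        withInt (((c - W i - D i j) / P i + m) * P i) fun l =>
        isNonneg (l - c - D j i) ||
          (isNonneg (c - l - W i - tighten D i j (c - l) i j) ||
            withTable (tighten (tighten D i j (c - l)) j i (l + W i - c)) fun D' =>
              rec D' i (l + W i))) fuel

/-- The points `x a`, `a < 4`, satisfy the strict difference bounds `D`; on the diagonal `D`
vanishes, so that only the weak inequality holds. -/
def SatisfiesBounds (x : ℕ → ℝ) (D : ℕ → ℕ → ℤ) : Prop :=
  ∀ a < 4, ∀ b < 4, x a - x b ≤ D a b ∧ (a ≠ b → x a - x b < D a b)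

theorem SatisfiesBounds.tighten {D : ℕ → ℕ → ℤ} {i j : ℕ} {c : ℤ} {x : ℕ → ℝ}
    (hi : i < 4) (hj : j < 4) (hD : SatisfiesBounds x D) (h : x i - x j < c) :
    SatisfiesBounds x (tighten D i j c) := by
  intro a ha b hb
  have h1 := (hD a ha i hi).1
  have h2 := (hD j hj b hb).1
  have h3 : x a - x b < ((D a i + c + D j b : ℤ) : ℝ) := by push_cast; linarith
  rw [LonelyRunner.tighten]
  cases isNonneg (D a i + c + D j b - D a b)
  · exact ⟨h3.le, fun _ => h3⟩
  · exact hD a ha b hb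

theorem exists_of_withTable {D : ℕ → ℕ → ℤ} {f : (ℕ → ℕ → ℤ) → Bool}
    (h : withTable D f = true) :
    ∃ D', (∀ x, SatisfiesBounds x D → SatisfiesBounds x D') ∧ f D' = true := by
  simp only [withTable, withInt_eq] at h
  refine ⟨_, fun x hx a ha b hb => ?_, h⟩
  have := hx a ha b hb
  interval_cases a <;> interval_cases b <;> simp_all [pick]

/-- An actual covering guides the search along a branch that never dies: the right endpoint of the
current open interval is not in it, so it lies in another interval. The bounds expressing this hold
for the true starting points, hence are consistent, and the search goes on until the fuel is spent.
-/
theorem noCover_spec {P W : ℕ → ℤ} (hW : ∀ i < 4, W i ≤ P i) (hP : ∀ i < 4, 0 < P i)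
    {x : ℕ → ℝ}
    (hx : ∀ t : ℝ, ∃ i < 4, ∃ k : ℤ, x i + k * P i < t ∧ t < x i + k * P i + W i) (fuel : ℕ) :
    ∀ (D : ℕ → ℕ → ℤ) (j : ℕ) (k₀ c : ℤ), j < 4 → c = k₀ * P j + W j →
      SatisfiesBounds x D → noCover P W fuel D j c = false := by
  induction fuel with
  | zero => exact fun D j k₀ c _ _ _ => rfl
  | succ n ih =>
    intro D j k₀ c hj hc hD
    by_contra hne
    rw [Bool.not_eq_false] at hne
    have hne : (allBelow 4 fun i => Nat.beq i j ||
      allBelow ((c + D j i) / P i - (c - W i - D i j) / P i + 1).toNat fun m =>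
        withInt (((c - W i - D i j) / P i + m) * P i) fun l =>
        isNonneg (l - c - D j i) ||
          (isNonneg (c - l - W i - tighten D i j (c - l) i j) ||
            withTable (tighten (tighten D i j (c - l)) j i (l + W i - c)) fun D' =>
              noCover P W n D' i (l + W i))) = true := hne
    simp only [withInt_eq] at hne
    obtain ⟨i, hi, k, h1, h2⟩ := hx (x j + c)
    -- Intervals of one runner are disjoint because `W i ≤ P i`, so none of them contains the
    -- endpoint of another.
    have hij : i ≠ j := by
      rintro rfl
      have g1 : (k * P i : ℝ) < c := by linarith
      have g2 : (c : ℝ) < k * P i + W i := by linarith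
      have g1' : k * P i < c := by exact_mod_cast g1
      have g2' : c < k * P i + W i := by exact_mod_cast g2
      have hPi := hP i hi
      have hWi := hW i hi
      have : k₀ < k := by
        by_contra hk
        nlinarith [mul_le_mul_of_nonneg_right (not_lt.1 hk) hPi.le]
      nlinarith [mul_le_mul_of_nonneg_right (Int.add_one_le_iff.2 this) hPi.le]
    have hPi := hP i hi
    have b1 := (hD j hj i hi).2 hij.symm
    have b2 := (hD i hi j hj).2 hij
    -- The known bounds on `x i - x j` confine `k` to the finite range enumerated by the search.
    have u1 : k * P i < c + D j i := by
      have : (k * P i : ℝ) < c + D j i := by linarith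
      exact_mod_cast this
    have u2 : c - W i - D i j < k * P i := by
      have : (c - W i - D i j : ℝ) < k * P i := by linarith
      exact_mod_cast this
    have k1 : k ≤ (c + D j i) / P i := (Int.le_ediv_iff_mul_le hPi).2 u1.le
    have k2 : (c - W i - D i j) / P i ≤ k := by
      refine Int.le_of_lt_add_one ((Int.ediv_lt_iff_lt_mul hPi).2 ?_)
      linarith
    rw [allBelow_eq_true] at hne
    have hne := hne i hi
    rw [Bool.or_eq_true, Nat.beq_eq] at hne
    replace hne := hne.resolve_left hij
    rw [allBelow_eq_true] at hne
    have hm : ((k - (c - W i - D i j) / P i).toNat : ℤ) = k - (c - W i - D i j) / P i :=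
      Int.toNat_of_nonneg (by linarith)
    have hne := hne (k - (c - W i - D i j) / P i).toNat (by omega)
    rw [hm, add_sub_cancel] at hne
    have c1 : x i - x j < ((c - k * P i : ℤ) : ℝ) := by push_cast; linarith
    have c2 : x j - x i < ((k * P i + W i - c : ℤ) : ℝ) := by push_cast; linarith
    have D1 := hD.tighten hi hj c1
    have D2 := D1.tighten hj hi c2
    rw [Bool.or_eq_true, Bool.or_eq_true, isNonneg_eq_true, isNonneg_eq_true] at hne
    rcases hne with h | h | h
    · have : (0 : ℝ) < ((c - k * P i + D j i : ℤ) : ℝ) := by push_cast at c1 ⊢; linarith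
      have : 0 < c - k * P i + D j i := by exact_mod_cast this
      linarith
    · have := (D1 i hi j hj).2 hij
      have : (0 : ℝ) < ((k * P i + W i - c + tighten D i j (c - k * P i) i j : ℤ) : ℝ) := by
        push_cast at c2 ⊢; linarith
      have : 0 < k * P i + W i - c + tighten D i j (c - k * P i) i j := by exact_mod_cast this
      linarith
    · obtain ⟨D', hD', h⟩ := exists_of_withTable h
      exact Bool.false_ne_true ((ih D' i k _ hi rfl (hD' x D2)).symm.trans h)

/-- The test by search of all coverings of the circle by the bad time intervals of the runners
`a`, `b`, `c`, `d`, for a common multiple `L` of the speeds; the time unit is `1 / (5 L)`. -/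
def coverTest (v : ℕ → ℕ) (L : ℕ) : Bool :=
  (allBelow 4 fun i => Nat.beq (L / v i * v i) L) && (Nat.ble 1 L &&
    -- In the unit `1 / (5 L)` runner `i` has period `5 L / v i` and is bad for `2/5` of it.
    -- Starting points are normalized to `x 0 ≤ x i < x 0 + P i`; the weak bound `x 0 - x i ≤ 0`
    -- enters as the strict bound `< 1`. The search starts at the right endpoint `W 0` of an
    -- interval of runner `0`.
    noCover (fun i => ((5 * (L / v i) : ℕ) : ℤ)) (fun i => ((2 * (L / v i) : ℕ) : ℤ)) 20
      (fun a b => if a = b then 0 else if a = 0 then 1 else ((5 * (L / v a) : ℕ) : ℤ)) 0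
      ((2 * (L / v 0) : ℕ) : ℤ))

theorem MeetsCube.of_coverTest {v : ℕ → ℕ} {L : ℕ} (h : coverTest v L = true) :
    MeetsCube fun i => (v i : ℤ) := by
  simp only [coverTest, Bool.and_eq_true, allBelow_eq_true, Nat.beq_eq, Nat.ble_eq] at h
  obtain ⟨hdvd, hL, h⟩ := h
  have hq : ∀ i < 4, 0 < L / v i := fun i hi => by
    refine Nat.pos_of_ne_zero fun h0 => ?_
    have := hdvd i hi
    rw [h0] at this
    omega
  have hv : ∀ i < 4, 0 < v i := fun i hi => by
    refine Nat.pos_of_ne_zero fun h0 => ?_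
    have := hdvd i hi
    rw [h0] at this
    omega
  intro s
  by_contra hbad
  push Not at hbad
  set P : ℕ → ℤ := fun i => ((5 * (L / v i) : ℕ) : ℤ) with hPdef
  set W : ℕ → ℤ := fun i => ((2 * (L / v i) : ℕ) : ℤ) with hWdef
  have hP : ∀ i < 4, 0 < P i := fun i hi => by
    have := hq i hi
    simp only [hPdef]
    omega
  have hPv : ∀ i < 4, (P i : ℝ) * v i = 5 * L := fun i hi => by
    have := hdvd i hi
    have e : ((L / v i * v i : ℕ) : ℝ) = L := by rw [this]
    rw [Nat.cast_mul] at e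
    simp only [hPdef, Nat.cast_mul, Nat.cast_ofNat, Int.cast_mul, Int.cast_ofNat,
      Int.cast_natCast]
    linarith
  have hWP : ∀ i < 4, (W i : ℝ) = 2 / 5 * P i := fun i hi => by
    simp only [hPdef, hWdef]
    push_cast
    ring
  have hL' : (0 : ℝ) < L := by exact_mod_cast hL
  -- the bad intervals cover the line
  set s' : ℕ → ℝ := fun i => if hi : i < 4 then s ⟨i, hi⟩ else 0 with hs'
  set y : ℕ → ℝ := fun i => (s' i - 7 / 10) / v i * (5 * L)
  have hy : ∀ t : ℝ, ∃ i < 4, ∃ k : ℤ, y i + k * P i < t ∧ t < y i + k * P i + W i := by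
    intro t
    obtain ⟨i, hi⟩ := hbad (t / (5 * L)) fun i => ⌊s i - t / (5 * L) * v i⌋
    -- Failure at the nearest integers gives a runner whose fractional part lies strictly between
    -- `3/10` and `7/10`; solving for `t` gives the bad interval starting at `(s i - 7/10) / v i`,
    -- up to periods.
    obtain ⟨i', hi'⟩ := hbad (t / (5 * L)) fun i => round (s i - t / (5 * L) * v i)
    refine ⟨i', i'.2, -⌊s i' - t / (5 * L) * v i'⌋, ?_⟩
    have hvi : (0 : ℝ) < v i' := by exact_mod_cast hv i' i'.2
    have hs : s' i' = s i' := by simp [hs']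
    have hfl := Int.floor_le (s i' - t / (5 * L) * v i')
    have hfl' := Int.lt_floor_add_one (s i' - t / (5 * L) * v i')
    set z := s i' - t / (5 * L) * v i' with hz
    have r1 : (3 / 10 : ℝ) < |z - ⌊z⌋| :=
      hi'.trans_le (by simpa [hz] using round_le z ⌊z⌋)
    have r2 : (3 / 10 : ℝ) < |z - (⌊z⌋ + 1 : ℤ)| :=
      hi'.trans_le (by simpa [hz] using round_le z (⌊z⌋ + 1))
    rw [abs_of_nonneg (by linarith)] at r1
    rw [abs_of_neg (by push_cast; linarith)] at r2
    push_cast at r2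
    have ht : t = (s i' - z) / v i' * (5 * L) := by
      rw [hz]
      field_simp
      ring
    have hPi : (P i' : ℝ) = 5 * L / v i' := by
      rw [eq_div_iff hvi.ne']
      exact hPv i' i'.2
    rw [hWP i' i'.2, hPi]
    simp only [y, hs]
    rw [ht]
    have hc : (0 : ℝ) < 5 * L / v i' := by positivity
    constructor
    · have : (s i' - z) / v i' * (5 * L) - ((s i' - 7 / 10) / v i' * (5 * L) +
          ((-⌊z⌋ : ℤ) : ℝ) * (5 * L / v i')) = (7 / 10 - (z - ⌊z⌋)) * (5 * L / v i') := by
        push_cast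
        ring
      have h2 : 0 < (7 / 10 - (z - ⌊z⌋)) * (5 * L / v i') := mul_pos (by linarith) hc
      linarith
    · have : (s i' - 7 / 10) / v i' * (5 * L) + ((-⌊z⌋ : ℤ) : ℝ) * (5 * L / v i') +
          2 / 5 * (5 * L / v i') - (s i' - z) / v i' * (5 * L) =
          (z - ⌊z⌋ - 3 / 10) * (5 * L / v i') := by
        push_cast
        ring
      have h2 : 0 < (z - ⌊z⌋ - 3 / 10) * (5 * L / v i') := mul_pos (by linarith) hc
      linarith
  -- normalize the starting points
  set x : ℕ → ℝ := fun i => y i - ⌊(y i - y 0) / P i⌋ * P i with hx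
  have hx0 : x 0 = y 0 := by simp [hx]
  have hxb : ∀ i < 4, x 0 ≤ x i ∧ x i < x 0 + P i := by
    intro i hi
    have hPi : (0 : ℝ) < P i := by exact_mod_cast hP i hi
    have h1 := Int.floor_le ((y i - y 0) / P i)
    have h2 := Int.lt_floor_add_one ((y i - y 0) / P i)
    rw [le_div_iff₀ hPi] at h1
    rw [div_lt_iff₀ hPi] at h2
    rw [hx0]
    simp only [hx]
    constructor <;> linarith
  have hxc : ∀ t : ℝ, ∃ i < 4, ∃ k : ℤ, x i + k * P i < t ∧ t < x i + k * P i + W i := by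
    intro t
    obtain ⟨i, hi, k, h1, h2⟩ := hy t
    refine ⟨i, hi, k + ⌊(y i - y 0) / P i⌋, ?_⟩
    simp only [hx]
    push_cast
    constructor <;> linarith
  have := noCover_spec (P := P) (W := W)
    (fun i hi => by simp only [hPdef, hWdef]; omega) hP hxc 20
    (fun a b => if a = b then 0 else if a = 0 then 1 else P a) 0 0 (W 0) (by norm_num) (by ring)
    (by
      intro a ha b hb
      have hPa := hP a ha
      have h1 := hxb a ha
      have h2 := hxb b hb
      beta_reduce
      split_ifs with hab h0
      · subst hab
        simp
      · subst h0
        push_cast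
        exact ⟨by linarith, fun _ => by linarith⟩
      · exact ⟨by linarith, fun _ => by linarith⟩)
  exact Bool.false_ne_true (this.symm.trans h)

/-! ### The certificates and the enumeration of speeds -/

def quad (a b c d : ℕ) : ℕ → ℕ
  | 0 => a
  | 1 => b
  | 2 => c
  | _ => d

/-- The absolute value of the minor of `v`, `w`, `u` with rows `i`, `j`, `k`. -/
def minor (v w u : ℕ → ℤ) (i j k : ℕ) : ℕ :=
  Int.natAbs (v i * (w j * u k - w k * u j) - v j * (w i * u k - w k * u i)
    + v k * (w i * u j - w j * u i))

/-- The side of the free box in coordinate `k`, times `5 N₁ N₂`. -/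
def slack (v w u : ℕ → ℤ) (N₁ T₁ N₂ T₂ E : ℤ) (k : ℕ) : ℤ :=
  3 * N₁ * N₂ - 5 * N₂ * Int.natAbs (N₁ * w k - T₁ * v k)
    - 5 * N₁ * Int.natAbs (N₂ * u k - T₂ * v k - E * (N₁ * w k - T₁ * v k))

/-- The test of the hypotheses of `MeetsCube.of_box` for `N₁ (w - τ₁ v) = N₁ w - T₁ v` and
`N₂ (u - τ₂ v - κ w) = N₂ u - T₂ v - E (N₁ w - T₁ v)`. -/
def stepTest (v w u : ℕ → ℤ) (N₁ T₁ N₂ T₂ E : ℤ) : Bool :=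
  isNonneg (N₁ - 1) && (isNonneg (N₂ - 1) &&
  (withInt (slack v w u N₁ T₁ N₂ T₂ E 0) fun h₀ => isNonneg h₀ &&
  (withInt (slack v w u N₁ T₁ N₂ T₂ E 1) fun h₁ => isNonneg h₁ &&
  (withInt (slack v w u N₁ T₁ N₂ T₂ E 2) fun h₂ => isNonneg h₂ &&
  (withInt (slack v w u N₁ T₁ N₂ T₂ E 3) fun h₃ => isNonneg h₃ &&
  (withNat (minor v w u 1 2 3) fun m₀ => withNat (minor v w u 0 2 3) fun m₁ =>
   withNat (minor v w u 0 1 3) fun m₂ => withNat (minor v w u 0 1 2) fun m₃ =>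
  (withNat (Nat.gcd (Nat.gcd m₀ m₁) (Nat.gcd m₂ m₃)) fun g => Nat.ble 1 g &&
  isNonneg (m₀ * h₀ + m₁ * h₁ + m₂ * h₂ + m₃ * h₃ - 5 * N₁ * N₂ * g))))))))

/-- `stepTest` with the parameters for which the first step has absolute value `3 / 5` in
coordinate `i` (with sign `-s`), and the second step vanishes in coordinate `i` and uses up the
whole available room in coordinate `j` (if `σ ≠ 0`, with sign `σ`) or vanishes there. -/
def pinTest (v w u : ℕ → ℤ) (i : ℕ) (s : ℤ) (j : ℕ) (σ : ℤ) : Bool :=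
  withInt (5 * v i) fun N => withInt (5 * w i + 3 * s) fun T =>
  (allBelow 4 fun k => Nat.ble (5 * Int.natAbs (N * w k - T * v k)) (3 * Int.natAbs N)) &&
  (withInt (N * w j - T * v j) fun X =>
  withInt (5 * (u j * v i - u i * v j) - σ * (3 * v i - Int.natAbs X)) fun E =>
  withInt (3 * s * v j + X) fun F => withInt (Int.sign F * E) fun E' =>
  withInt (Int.natAbs F) fun F' => withInt (5 * F' * u i + 3 * s * E') fun T' =>
  withInt (N * F') fun N' => stepTest v w u N T N' T' E')

/-- In each line `x` is the speed of one tested runner. A time of the form `5 d o`, with `o` its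
target, places it exactly there; the correction `±(3 d - 2 x)` places it at the end of its available
room instead. -/
def fixedTests (a b c d : ℕ) : Bool :=
  boxTest a b c d 0 0 1 c (5 * d - (3 * d - 2 * c)) ||
  (boxTest a b c d 0 1 1 b (5 * d - (3 * d - 2 * b)) ||
  (boxTest a b c d 1 1 1 c (5 * d + (3 * d - 2 * c)) ||
  (boxTest a b c d 1 2 2 c (10 * d + (3 * d - 2 * c)) ||
  (boxTest a b c d 1 1 2 c (10 * d - (3 * d - 2 * c)) ||
  (boxTest a b c d 0 1 1 c (5 * d) ||
  (boxTest a b c d 1 1 1 b (5 * d) ||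
  (boxTest a b c d 0 1 2 c (10 * d - (3 * d - 2 * c)) ||
  (boxTest a b c d 1 2 2 c (10 * d) ||
  (boxTest a b c d 1 1 2 c (10 * d) ||
  (boxTest a b c d 2 3 4 b (15 * d) ||
  boxTest a b c d 1 3 3 b (15 * d - (3 * d - 2 * b))))))))))))

/-- The third and fourth runners exchange roles, so the reference speed is no longer the largest;
the guard keeps `3 c - 2 d` from truncating. -/
def swapTests (a b c d : ℕ) : Bool :=
  Nat.ble (2 * d) (3 * c) &&
  (boxTest a b d c 0 1 1 b (5 * c - (3 * c - 2 * b)) ||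
  (boxTest a b d c 1 2 4 d (20 * c - (3 * c - 2 * d)) ||
  (boxTest a b d c 1 1 1 d (5 * c + (3 * c - 2 * d)) ||
  (boxTest a b d c 1 1 2 d (10 * c - (3 * c - 2 * d)) ||
  (boxTest a b d c 0 1 2 d (10 * c - (3 * c - 2 * d)) ||
  boxTest a b d c 0 2 3 d (15 * c - (3 * c - 2 * d)))))))

def vec (a b c d : ℕ) : ℕ → ℤ := fun i => (quad a b c d i : ℤ)

def pinTests (v : ℕ → ℤ) : Bool :=
  pinTest v (vec 0 1 1 1) (vec 1 1 1 1) 0 1 2 0 ||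
  (pinTest v (vec 0 1 2 2) (vec 0 1 1 1) 2 (-1) 1 1 ||
  (pinTest v (vec 0 0 1 1) (vec 0 1 1 2) 2 (-1) 1 1 ||
  (pinTest v (vec 1 1 1 2) (vec 0 0 1 1) 2 1 3 1 ||
  (pinTest v (vec 1 1 1 1) (vec 0 0 1 1) 3 1 0 0 ||
  (pinTest v (vec 0 0 1 1) (vec 0 1 0 2) 2 (-1) 3 0 ||
  (pinTest v (vec 1 2 2 2) (vec 0 1 1 1) 0 1 2 0 ||
  (pinTest v (vec 0 1 2 2) (vec 0 0 1 1) 0 1 1 (-1) ||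
  (pinTest v (vec 0 0 1 1) (vec 0 1 1 2) 2 (-1) 3 0 ||
  (pinTest v (vec 0 1 1 1) (vec 1 1 1 2) 0 1 1 0 ||
  (pinTest v (vec 1 1 1 1) (vec 0 1 1 1) 0 (-1) 2 0 ||
  (pinTest v (vec 0 0 1 1) (vec 1 1 1 2) 2 (-1) 0 1 ||
  (pinTest v (vec 0 0 1 0) (vec 1 1 2 2) 2 (-1) 3 (-1) ||
  (pinTest v (vec 0 0 1 1) (vec 0 0 1 0) 1 1 3 (-1) ||
  (pinTest v (vec 0 1 1 2) (vec 0 1 1 1) 3 (-1) 2 0 ||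
  (pinTest v (vec 0 1 1 2) (vec 0 0 1 1) 3 (-1) 2 1 ||
  (pinTest v (vec 0 1 1 2) (vec 1 1 1 2) 0 1 2 (-1) ||
  (pinTest v (vec 0 1 1 1) (vec 0 0 1 1) 1 (-1) 2 0 ||
  (pinTest v (vec 0 0 1 1) (vec 0 1 0 1) 1 1 2 (-1) ||
  pinTest v (vec 1 1 2 2) (vec 0 0 0 1) 3 1 2 0))))))))))))))))))

/-- All tests for the speeds `a < b < c < e` with `d ≤ e` and sum at most `195`. -/
def walk (a b c fuel : ℕ) : ℕ → Bool :=
  Nat.rec (fun _ => false) (fun _ rec d =>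
    Nat.ble 196 (a + b + c + d) ||
      (bif Nat.beq (Nat.gcd (Nat.gcd a b) (Nat.gcd c d)) 1 then
        fixedTests a b c d || ((swapTests a b c d || (pinTests (vec a b c d) ||
          coverTest (quad a b c d) (a * b * c * d))) && rec (d + 1))
      else rec (d + 1))) fuel

/-- `walk` from `c + 1` for all `a < b < c`, `0 < a`. -/
def sliceTest (c : ℕ) : Bool :=
  allBelow (c - 1) fun b => allBelow b fun a => walk (a + 1) (b + 1) c 195 (c + 1)

/-- `sliceTest` for `l ≤ c < l + n`. -/
def rangeTest (l n : ℕ) : Bool := allBelow n fun c => sliceTest (c + l)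

/-! ### Soundness of the tests -/

theorem exists_bezout_four (x : Fin 4 → ℤ) :
    ∃ z : Fin 4 → ℤ, ∑ i, x i * z i = (Nat.gcd (Nat.gcd (x 0).natAbs (x 1).natAbs)
      (Nat.gcd (x 2).natAbs (x 3).natAbs) : ℤ) := by
  have h1 := Int.gcd_eq_gcd_ab (x 0) (x 1)
  have h2 := Int.gcd_eq_gcd_ab (x 2) (x 3)
  have h3 := Int.gcd_eq_gcd_ab (Int.gcd (x 0) (x 1)) (Int.gcd (x 2) (x 3))
  refine ⟨![Int.gcdA (x 0) (x 1) * Int.gcdA (Int.gcd (x 0) (x 1)) (Int.gcd (x 2) (x 3)),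
    Int.gcdB (x 0) (x 1) * Int.gcdA (Int.gcd (x 0) (x 1)) (Int.gcd (x 2) (x 3)),
    Int.gcdA (x 2) (x 3) * Int.gcdB (Int.gcd (x 0) (x 1)) (Int.gcd (x 2) (x 3)),
    Int.gcdB (x 2) (x 3) * Int.gcdB (Int.gcd (x 0) (x 1)) (Int.gcd (x 2) (x 3))], ?_⟩
  have h4 : ((Nat.gcd (Nat.gcd (x 0).natAbs (x 1).natAbs)
      (Nat.gcd (x 2).natAbs (x 3).natAbs) : ℕ) : ℤ) =
      Int.gcd (Int.gcd (x 0) (x 1)) (Int.gcd (x 2) (x 3)) := by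
    simp [Int.gcd]
  rw [h4, h3]
  simp only [Fin.sum_univ_four, Matrix.cons_val]
  linear_combination (-Int.gcdA (Int.gcd (x 0) (x 1)) (Int.gcd (x 2) (x 3))) * h1
    - Int.gcdB (Int.gcd (x 0) (x 1)) (Int.gcd (x 2) (x 3)) * h2

theorem natAbs_cross (v w u : ℕ → ℤ) :
    (cross (fun i : Fin 4 => v i) (fun i => w i) (fun i => u i) 0).natAbs = minor v w u 1 2 3 ∧
    (cross (fun i : Fin 4 => v i) (fun i => w i) (fun i => u i) 1).natAbs = minor v w u 0 2 3 ∧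
    (cross (fun i : Fin 4 => v i) (fun i => w i) (fun i => u i) 2).natAbs = minor v w u 0 1 3 ∧
    (cross (fun i : Fin 4 => v i) (fun i => w i) (fun i => u i) 3).natAbs = minor v w u 0 1 2 :=
  ⟨rfl, Int.natAbs_neg _, rfl, Int.natAbs_neg _⟩

theorem MeetsCube.of_stepTest {v w u : ℕ → ℤ} {N₁ T₁ N₂ T₂ E : ℤ}
    (h : stepTest v w u N₁ T₁ N₂ T₂ E = true) : MeetsCube fun i => v i := by
  simp only [stepTest, withInt_eq, withNat_eq, Bool.and_eq_true, isNonneg_eq_true,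
    Nat.ble_eq] at h
  obtain ⟨hN1, hN2, h0, h1, h2, h3, hg, hS⟩ := h
  obtain ⟨c0, c1, c2, c3⟩ := natAbs_cross v w u
  set m := cross (fun i : Fin 4 => v i) (fun i => w i) (fun i => u i) with hm
  obtain ⟨z, hz⟩ := exists_bezout_four m
  rw [c0, c1, c2, c3] at hz
  have hN1' : (0 : ℝ) < N₁ := by
    have : (0 : ℤ) < N₁ := by linarith
    exact_mod_cast this
  have hN2' : (0 : ℝ) < N₂ := by
    have : (0 : ℤ) < N₂ := by linarith
    exact_mod_cast this
  have hD : (0 : ℝ) < 5 * N₁ * N₂ := by positivity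
  have hsl : ∀ i : Fin 4, 0 ≤ slack v w u N₁ T₁ N₂ T₂ E i := by
    intro i
    fin_cases i
    exacts [h0, h1, h2, h3]
  -- Dividing `N₂ u - T₂ v - E (N₁ w - T₁ v)` by `N₂` and collecting the coefficients of `v` and `w`
  -- gives `τ₂` and `κ`.
  refine MeetsCube.of_box (w := fun i => w i) (u := fun i => u i) (τ₁ := T₁ / N₁)
    (τ₂ := T₂ / N₂ - E * T₁ / N₂) (κ := E * N₁ / N₂)
    (h := fun i => (slack v w u N₁ T₁ N₂ T₂ E i : ℤ) / (5 * N₁ * N₂)) (z := z)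
    (fun i => div_nonneg (by exact_mod_cast hsl i) hD.le) ?_ (by exact_mod_cast hg) hz ?_
  · intro i
    have e1 : (w i : ℝ) - T₁ / N₁ * v i = (N₁ * w i - T₁ * v i) / N₁ := by field_simp
    have e2 : (u i : ℝ) - (T₂ / N₂ - E * T₁ / N₂) * v i - E * N₁ / N₂ * w i =
        (N₂ * u i - T₂ * v i - E * (N₁ * w i - T₁ * v i)) / N₂ := by
      field_simp
      ring
    rw [e1, e2, abs_div, abs_div, abs_of_pos hN1', abs_of_pos hN2', slack]
    push_cast [Nat.cast_natAbs]
    apply le_of_eq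
    field_simp
    ring
  · have hS' : (5 * N₁ * N₂ * ((Nat.gcd (Nat.gcd (minor v w u 1 2 3) (minor v w u 0 2 3))
        (Nat.gcd (minor v w u 0 1 3) (minor v w u 0 1 2)) : ℕ) : ℤ) : ℤ) ≤
        minor v w u 1 2 3 * slack v w u N₁ T₁ N₂ T₂ E 0 +
        minor v w u 0 2 3 * slack v w u N₁ T₁ N₂ T₂ E 1 +
        minor v w u 0 1 3 * slack v w u N₁ T₁ N₂ T₂ E 2 +
        minor v w u 0 1 2 * slack v w u N₁ T₁ N₂ T₂ E 3 := by linarith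
    have hS'' := (Int.cast_le (R := ℝ)).2 hS'
    have a : ∀ i, |((m i : ℤ) : ℝ)| = (m i).natAbs := fun i => by rw [Nat.cast_natAbs, Int.cast_abs]
    rw [← hm, Fin.sum_univ_four, a, a, a, a, c0, c1, c2, c3, ← mul_div_assoc, ← mul_div_assoc,
      ← mul_div_assoc, ← mul_div_assoc, ← add_div, ← add_div, ← add_div, le_div_iff₀ hD]
    push_cast at hS'' ⊢
    simp only [Fin.isValue, Fin.val_zero, Fin.val_one, Fin.val_two] at hS'' ⊢
    refine le_trans (le_of_eq ?_) hS''
    ring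

/-- Soundness rests on `stepTest` alone; the formulas for its parameters and the preliminary bound
only select a candidate. -/
theorem MeetsCube.of_pinTest {v w u : ℕ → ℤ} {i j : ℕ} {s σ : ℤ}
    (h : pinTest v w u i s j σ = true) : MeetsCube fun i => v i := by
  simp only [pinTest, withInt_eq, Bool.and_eq_true] at h
  exact MeetsCube.of_stepTest h.2

theorem MeetsCube.of_pinTests {v : ℕ → ℤ} (h : pinTests v = true) :
    MeetsCube fun i => v i := by
  simp only [pinTests, Bool.or_eq_true] at h
  rcases h with h | h | h | h | h | h | h | h | h | h | h | h | h | h | h | h | h | h | h | h <;>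
    exact MeetsCube.of_pinTest h

theorem quad_eq (a b c d : ℕ) :
    (fun i : Fin 4 => (quad a b c d i : ℤ)) = ![(a : ℤ), b, c, d] := by
  funext i
  fin_cases i <;> rfl

theorem MeetsCube.of_fixedTests {a b c d d' : ℕ} (hb0 : 0 < b) (hab : a < b) (hbc : b < c)
    (hcd : c < d) (hd : d ≤ d') (h : fixedTests a b c d = true) :
    MeetsCube ![(a : ℤ), b, c, d'] := by
  simp only [fixedTests, Bool.or_eq_true] at h
  rcases h with h | h | h | h | h | h | h | h | h | h | h | h <;>
    exact MeetsCube.of_boxTest (by omega) (by omega) hd (by omega) (by omega) (by omega) h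

theorem MeetsCube.of_swapTests {a b c d : ℕ} (hb0 : 0 < b) (hab : a < b) (hbc : b < c)
    (hcd : c < d) (h : swapTests a b c d = true) :
    MeetsCube ![(a : ℤ), b, c, d] := by
  simp only [swapTests, Bool.or_eq_true, Bool.and_eq_true, Nat.ble_eq] at h
  obtain ⟨hdc, h⟩ := h
  have key : MeetsCube ![(a : ℤ), b, d, c] := by
    rcases h with h | h | h | h | h | h <;>
      exact MeetsCube.of_boxTest (by omega) (by omega) le_rfl (by omega) (by omega) (by omega) h
  refine MeetsCube.of_perm (Equiv.swap 2 3) ?_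
  convert key using 1
  funext i
  fin_cases i <;> rfl

/-- A success of `fixedTests` at `d` covers every larger fourth speed and ends the walk; the other
tests settle only `d` itself. Exhausted fuel counts as failure. -/
theorem MeetsCube.of_walk {a b c d' : ℕ} (hb0 : 0 < b) (hab : a < b) (hbc : b < c)
    (hgcd : Nat.gcd (Nat.gcd a b) (Nat.gcd c d') = 1) (hsum : a + b + c + d' ≤ 195) (fuel : ℕ) :
    ∀ d, c < d → d ≤ d' → walk a b c fuel d = true → MeetsCube ![(a : ℤ), b, c, d'] := by
  induction fuel with
  | zero => exact fun d _ _ h => absurd h Bool.false_ne_true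
  | succ n ih =>
    intro d hcd hdd h
    have h : (Nat.ble 196 (a + b + c + d) ||
      (bif Nat.beq (Nat.gcd (Nat.gcd a b) (Nat.gcd c d)) 1 then
        fixedTests a b c d || ((swapTests a b c d || (pinTests (vec a b c d) ||
          coverTest (quad a b c d) (a * b * c * d))) && walk a b c n (d + 1))
      else walk a b c n (d + 1))) = true := h
    rw [Bool.or_eq_true, Nat.ble_eq] at h
    replace h := h.resolve_left (by omega)
    rcases Bool.eq_false_or_eq_true (Nat.beq (Nat.gcd (Nat.gcd a b) (Nat.gcd c d)) 1) with hg | hg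
    · rw [hg, cond_true, Bool.or_eq_true, Bool.and_eq_true] at h
      rcases h with h | ⟨h, h'⟩
      · exact MeetsCube.of_fixedTests hb0 hab hbc hcd hdd h
      · rcases hdd.eq_or_lt with rfl | hlt
        · simp only [Bool.or_eq_true] at h
          rcases h with h | h | h
          · exact MeetsCube.of_swapTests hb0 hab hbc hcd h
          · rw [← quad_eq]
            exact MeetsCube.of_pinTests h
          · rw [← quad_eq]
            exact MeetsCube.of_coverTest h
        · exact ih (d + 1) (by omega) hlt h'
    · rw [hg, cond_false] at h
      rcases hdd.eq_or_lt with rfl | hlt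
      · rw [hgcd] at hg
        exact absurd hg (by decide)
      · exact ih (d + 1) (by omega) hlt h

theorem MeetsCube.of_rangeTest {a b c d l n : ℕ} (h : rangeTest l n = true) (ha : 0 < a)
    (hab : a < b) (hbc : b < c) (hcd : c < d) (hl : l ≤ c) (hn : c < l + n)
    (hgcd : Nat.gcd (Nat.gcd a b) (Nat.gcd c d) = 1) (hsum : a + b + c + d ≤ 195) :
    MeetsCube ![(a : ℤ), b, c, d] := by
  simp only [rangeTest, sliceTest, allBelow_eq_true] at h
  have h := h (c - l) (by omega) (b - 1) (by omega) (a - 1) (by omega)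
  rw [Nat.sub_add_cancel hl, Nat.sub_add_cancel ha,
    Nat.sub_add_cancel (show 1 ≤ b by omega)] at h
  exact MeetsCube.of_walk (by omega) hab hbc hgcd hsum 195 (c + 1) (by omega) hcd h

/-! ### The finite check, split by the third speed -/

set_option maxRecDepth 100000 in
theorem rangeTest_zero : rangeTest 0 30 = true := by decide +kernel

set_option maxRecDepth 100000 in
theorem rangeTest_thirty : rangeTest 30 15 = true := by decide +kernel

set_option maxRecDepth 100000 in
theorem rangeTest_forty_five : rangeTest 45 15 = true := by decide +kernel

set_option maxRecDepth 100000 in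
theorem rangeTest_sixty : rangeTest 60 37 = true := by decide +kernel

theorem meetsCube_of_sum_le {a b c d : ℕ} (ha : 0 < a)
    (hab : a < b) (hbc : b < c) (hcd : c < d)
    (hgcd : Nat.gcd (Nat.gcd a b) (Nat.gcd c d) = 1) (hsum : a + b + c + d ≤ 195) :
    MeetsCube ![(a : ℤ), b, c, d] := by
  rcases lt_or_ge c 30 with h1 | h1
  · exact MeetsCube.of_rangeTest rangeTest_zero ha hab hbc hcd (by omega) (by omega) hgcd hsum
  rcases lt_or_ge c 45 with h2 | h2
  · exact MeetsCube.of_rangeTest rangeTest_thirty ha hab hbc hcd h1 h2 hgcd hsum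
  rcases lt_or_ge c 60 with h3 | h3
  · exact MeetsCube.of_rangeTest rangeTest_forty_five ha hab hbc hcd h2 h3 hgcd hsum
  -- The sum bound with `a ≥ 1`, `b ≥ 2`, `d ≥ c + 1` gives `c ≤ 95`, so the ranges up to `96`
  -- suffice.
  · exact MeetsCube.of_rangeTest rangeTest_sixty ha hab hbc hcd h3 (by omega) hgcd hsum

/-! ### The covering radius is attained -/

theorem isClosed_integerLattice (d : ℕ) : IsClosed (integerLattice d) := by
  have : integerLattice d = Set.pi Set.univ fun _ => Set.range ((↑) : ℤ → ℝ) := by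
    ext x
    simp only [integerLattice, Set.mem_range, Set.mem_pi, Set.mem_univ, true_imp_iff]
    constructor
    · rintro ⟨z, rfl⟩ i
      exact ⟨z i, rfl⟩
    · intro h
      choose z hz using h
      exact ⟨z, funext hz⟩
  rw [this]
  exact isClosed_set_pi fun _ _ => Int.isClosedEmbedding_coe_real.isClosed_range

theorem mem_coveringDilations_iff {d : ℕ} {C : Set (Fin d → ℝ)} {ρ : ℝ} :
    ρ ∈ coveringDilations C ↔ 0 < ρ ∧ ∀ x, ∃ z ∈ C, x - ρ • z ∈ integerLattice d := by
  refine and_congr_right fun _ => ?_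
  rw [Set.eq_univ_iff_forall]
  refine forall_congr' fun x => ?_
  rw [Set.mem_add]
  constructor
  · rintro ⟨_, ⟨z, hz, rfl⟩, n, hn, rfl⟩
    exact ⟨z, hz, by simpa using hn⟩
  · rintro ⟨z, hz, h⟩
    exact ⟨ρ • z, ⟨z, hz, rfl⟩, _, h, add_sub_cancel _ _⟩

/-- The covering radius of a compact set is attained. -/
theorem isLeast_coveringRadius {d : ℕ} (hd : d ≠ 0) {C : Set (Fin d → ℝ)} (hC : IsCompact C)
    (hne : (coveringDilations C).Nonempty) :
    IsLeast (coveringDilations C) (coveringRadius C) := by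
  have hbdd : BddBelow (coveringDilations C) := ⟨0, fun ρ hρ => hρ.1.le⟩
  refine ⟨?_, fun ρ hρ => csInf_le hbdd hρ⟩
  obtain ⟨ρ, -, hlim, hmem⟩ := exists_seq_tendsto_sInf hne hbdd
  have key : ∀ x, ∃ z ∈ C, x - coveringRadius C • z ∈ integerLattice d := by
    intro x
    -- The points of `C` used for dilation factors tending to the infimum accumulate in `C`, and the
    -- lattice is closed, so the limit factor still covers.
    choose z hz hzx using fun k => (mem_coveringDilations_iff.1 (hmem k)).2 x
    obtain ⟨y, hy, φ, hφ, hφy⟩ := hC.tendsto_subseq hz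
    refine ⟨y, hy, (isClosed_integerLattice d).mem_of_tendsto
      (tendsto_const_nhds.sub ((hlim.comp hφ.tendsto_atTop).smul hφy))
      (Filter.Eventually.of_forall fun k => hzx (φ k))⟩
  refine mem_coveringDilations_iff.2 ⟨lt_of_le_of_ne (le_csInf hne fun ρ hρ => hρ.1.le) ?_, key⟩
  intro h0
  -- With factor `0` every point would be a lattice point; `(1/2, …, 1/2)` is not, as `d ≠ 0`.
  obtain ⟨z, -, n, hn⟩ := key fun _ => 1 / 2
  have := congrFun hn ⟨0, Nat.pos_of_ne_zero hd⟩
  simp only [toReal, ← h0, zero_smul, sub_zero] at this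
  have h2 : ((2 * n ⟨0, Nat.pos_of_ne_zero hd⟩ : ℤ) : ℝ) = (1 : ℤ) := by
    push_cast
    linarith
  have h3 := Int.cast_injective h2
  omega

theorem isCompact_zonotope {d n : ℕ} (c : Fin d → ℝ) (u : Fin n → Fin d → ℝ) :
    IsCompact (zonotope c u) := by
  have : zonotope c u = (fun l : Fin n → ℝ => c + ∑ i, l i • u i) '' Set.Icc 0 1 := by
    ext x
    simp only [zonotope, Set.mem_ofPred_eq, Set.mem_image, Set.mem_Icc, Pi.le_def, Pi.zero_apply,
      Pi.one_apply, forall_and, eq_comm]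
  rw [this]
  exact isCompact_Icc.image (by fun_prop)

/-! ### From runners to zonotopes -/

/-- Each coordinate is the expansion of a `4 × 4` determinant in which a column of `U` is repeated.
-/
theorem det_smul_sum_eq_zero (U : Fin 4 → Fin 3 → ℤ) :
    ∑ i : Fin 4, ((-1) ^ (i : ℕ) * (Matrix.of fun j : Fin 3 => U (i.succAbove j)).det) • U i
      = 0 := by
  have h0 : ∀ j, (0 : Fin 4).succAbove j = ![1, 2, 3] j := by decide
  have h1 : ∀ j, (1 : Fin 4).succAbove j = ![0, 2, 3] j := by decide
  have h2 : ∀ j, (2 : Fin 4).succAbove j = ![0, 1, 3] j := by decide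
  have h3 : ∀ j, (3 : Fin 4).succAbove j = ![0, 1, 2] j := by decide
  funext k
  simp only [Fin.sum_univ_four, h0, h1, h2, h3, Matrix.det_fin_three, Matrix.of_apply,
    Matrix.cons_val, Pi.add_apply, Pi.smul_apply, smul_eq_mul, Pi.zero_apply]
  fin_cases k <;> simp <;> ring

/-- After a choice of signs, the volume vector gives the linear relation of the generators. -/
theorem exists_signs (U : Fin 4 → Fin 3 → ℤ) :
    ∃ ε : Fin 4 → ℤ, (∀ i, ε i * ε i = 1) ∧ ∑ i, (ε i * volumeVector U i) • U i = 0 := by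
  have : ∀ i : Fin 4, ∃ e : ℤ, e * e = 1 ∧
      (-1) ^ (i : ℕ) * (Matrix.of fun j : Fin 3 => U (i.succAbove j)).det =
        e * volumeVector U i := by
    intro i
    have hp : ((-1 : ℤ) ^ (i : ℕ)) * (-1) ^ (i : ℕ) = 1 := by
      rw [← mul_pow]
      simp
    rcases abs_choice (Matrix.of fun j : Fin 3 => U (i.succAbove j)).det with h | h
    · exact ⟨(-1) ^ (i : ℕ), hp, by rw [volumeVector, h]⟩
    · exact ⟨-(-1) ^ (i : ℕ), by linarith, by rw [volumeVector, h]; ring⟩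
  choose ε h1 h2 using this
  refine ⟨ε, h1, ?_⟩
  rw [← det_smul_sum_eq_zero U]
  exact Finset.sum_congr rfl fun i _ => by rw [h2]

theorem GeneralPosition.exists_coeff {U : Fin 4 → Fin 3 → ℤ} (hU : GeneralPosition U)
    (x : Fin 3 → ℝ) : ∃ y : Fin 4 → ℝ, x = ∑ i, y i • toReal (U i) := by
  have hs := (hU 0).span_eq_top_of_card_eq_finrank' (by simp)
  have hx : x ∈ Submodule.span ℝ (Set.range fun j : Fin 3 => toReal (U ((0 : Fin 4).succAbove j)))
  · rw [hs]
    trivial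
  obtain ⟨y, hy⟩ := (Submodule.mem_span_range_iff_exists_fun ℝ).1 hx
  refine ⟨Fin.cons 0 y, ?_⟩
  rw [Fin.sum_univ_succ, ← hy]
  simp

theorem toReal_sum_smul {ι : Type*} (s : Finset ι) {d : ℕ} (n : ι → ℤ) (U : ι → Fin d → ℤ) :
    toReal (∑ i ∈ s, n i • U i) = ∑ i ∈ s, (n i : ℝ) • toReal (U i) := by
  funext k
  simp [toReal, Finset.sum_apply]

/-- Coefficients of a point of `3/5 • Z` range over `[0, 3/5]`, the ball of radius `3/10` about
`3/10`. So `MeetsCube` is applied to `y - 3/10`, twisted by the signs `ε` that turn the volume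
vector into the relation; moving along the relation fixes the point, and the integer part becomes
the lattice vector. -/
theorem MeetsCube.mem_coveringDilations {U : Fin 4 → Fin 3 → ℤ} (hU : GeneralPosition U)
    (h : MeetsCube (volumeVector U)) (c : Fin 3 → ℝ) :
    3 / 5 ∈ coveringDilations (zonotope c fun i => toReal (U i)) := by
  refine mem_coveringDilations_iff.2 ⟨by norm_num, fun x => ?_⟩
  obtain ⟨ε, hε, hrel⟩ := exists_signs U
  obtain ⟨y, hy⟩ := hU.exists_coeff (x - (3 / 5 : ℝ) • c)
  obtain ⟨t, n, hn⟩ := h fun i => ε i * (y i - 3 / 10)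
  have hrel' : ∑ i, ((ε i * volumeVector U i : ℤ) : ℝ) • toReal (U i) = 0 := by
    rw [← toReal_sum_smul, hrel]
    funext k
    simp [toReal]
  have hε' : ∀ i, (ε i : ℝ) * ε i = 1 := fun i => by exact_mod_cast hε i
  set l : Fin 4 → ℝ := fun i => y i - t * (ε i * volumeVector U i : ℤ) - (ε i * n i : ℤ) with hl
  have hlb : ∀ i, |l i - 3 / 10| ≤ 3 / 10 := by
    intro i
    have e : l i - 3 / 10 =
        ε i * (ε i * (y i - 3 / 10) - t * volumeVector U i - n i) := by
      rw [hl]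
      push_cast
      linear_combination (3 / 10 - y i) * hε' i
    have e1 : |(ε i : ℝ)| = 1 := by
      have := hε' i
      rw [← abs_mul_abs_self] at this
      nlinarith [abs_nonneg (ε i : ℝ)]
    rw [e, abs_mul, e1, one_mul]
    exact hn i
  refine ⟨c + ∑ i, (5 / 3 * l i) • toReal (U i), ⟨fun i => 5 / 3 * l i, fun i => ?_, rfl⟩,
    ∑ i, (ε i * n i) • U i, ?_⟩
  · have := abs_le.1 (hlb i)
    constructor <;> linarith [this.1, this.2]
  · rw [toReal_sum_smul]
    have e1 : x = (3 / 5 : ℝ) • c + ∑ i, y i • toReal (U i) := by rw [← hy]; abel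
    have e2 : ∑ i, y i • toReal (U i) = ∑ i, l i • toReal (U i)
        + t • ∑ i, ((ε i * volumeVector U i : ℤ) : ℝ) • toReal (U i)
        + ∑ i, ((ε i * n i : ℤ) : ℝ) • toReal (U i) := by
      rw [Finset.smul_sum, ← Finset.sum_add_distrib, ← Finset.sum_add_distrib]
      refine Finset.sum_congr rfl fun i _ => ?_
      rw [smul_smul, ← add_smul, ← add_smul]
      congr 1
      rw [hl]
      ring
    rw [e1, e2, hrel', smul_zero, add_zero, smul_add, Finset.smul_sum]
    have e3 : ∀ i, (3 / 5 : ℝ) • (5 / 3 * l i) • toReal (U i) = l i • toReal (U i) := fun i => by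
      rw [smul_smul]
      congr 1
      ring
    rw [Finset.sum_congr rfl fun i _ => e3 i]
    abel

/-! ### A zonotope determines its generators up to sign and order -/

theorem abs_add_abs_sub_of_le {x y : ℝ} (h : |y| ≤ |x|) : |x + y| + |x - y| = 2 * |x| := by
  rcases abs_cases x with ⟨hx, _⟩ | ⟨hx, _⟩ <;> rw [hx] at h ⊢ <;> have := abs_le.1 h
  · rw [abs_of_nonneg (by linarith), abs_of_nonneg (by linarith)]
    ring
  · rw [abs_of_nonpos (by linarith), abs_of_nonpos (by linarith)]
    ring

open Module in
/-- A sum of absolute values of pairwise independent linear forms determines these forms up to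
sign. -/
theorem exists_eq_or_neg_of_sum_abs_eq {V ι : Type*} [AddCommGroup V] [Module ℝ V] [Fintype ι]
    {u w : ι → V} (hu0 : ∀ i, u i ≠ 0) (hw0 : ∀ i, w i ≠ 0)
    (hu : ∀ i j, i ≠ j → u j ∉ Submodule.span ℝ {u i})
    (hw : ∀ i j, i ≠ j → w j ∉ Submodule.span ℝ {w i})
    (h : ∀ f : Dual ℝ V, ∑ i, |f (u i)| = ∑ i, |f (w i)|) (i : ι) :
    ∃ j, w j = u i ∨ w j = -u i := by
  classical
  -- A generic form in the annihilator of `u i`: among all the vectors `u k`, `w k` it kills only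
  -- those on the line of `u i`.
  obtain ⟨f₀, hf₀, hne⟩ := Dual.exists_forall_mem_ne_zero_of_forall_exists
    (LinearMap.ker (Dual.eval ℝ V (u i)))
    (fun k : {k : ι ⊕ ι // Sum.elim u w k ∉ Submodule.span ℝ {u i}} =>
      Dual.eval ℝ V (Sum.elim u w k)) (by
    rintro ⟨k, hk⟩
    obtain ⟨f, hf, hf'⟩ := Submodule.exists_dual_map_eq_bot_of_notMem hk inferInstance
    refine ⟨f, ?_, hf⟩
    have : f (u i) ∈ (Submodule.span ℝ {u i}).map f :=
      Submodule.mem_map_of_mem (Submodule.mem_span_singleton_self _)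
    rw [hf', Submodule.mem_bot] at this
    simpa using this)
  replace hf₀ : f₀ (u i) = 0 := by simpa using hf₀
  replace hne : ∀ k, f₀ (Sum.elim u w k) = 0 → Sum.elim u w k ∈ Submodule.span ℝ {u i} := by
    intro k hk
    by_contra hk'
    exact hne ⟨k, hk'⟩ hk
  have hu' : ∀ k, f₀ (u k) = 0 ↔ k = i := by
    refine fun k => ⟨fun hk => ?_, fun hk => hk ▸ hf₀⟩
    by_contra hki
    exact hu i k (Ne.symm hki) (hne (Sum.inl k) hk)
  -- The second difference of the sum of absolute values at `f₀` in a small direction `ε f` sees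
  -- only the terms with a kink at `f₀`, those whose vector is killed by `f₀`.
  have key : ∀ f : Dual ℝ V, |f (u i)| = ∑ j, if f₀ (w j) = 0 then |f (w j)| else 0 := by
    intro f
    have hev : ∀ᶠ ε : ℝ in nhdsWithin 0 (Set.Ioi 0), ∀ k : ι ⊕ ι, f₀ (Sum.elim u w k) ≠ 0 →
        |ε * f (Sum.elim u w k)| ≤ |f₀ (Sum.elim u w k)| := by
      refine Filter.eventually_all.2 fun k => ?_
      by_cases hk : f₀ (Sum.elim u w k) = 0
      · exact Filter.Eventually.of_forall fun ε h => absurd hk h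
      · have hc : Filter.Tendsto (fun ε : ℝ => |ε * f (Sum.elim u w k)|)
            (nhdsWithin 0 (Set.Ioi 0)) (nhds 0) := by
          have : Continuous fun ε : ℝ => |ε * f (Sum.elim u w k)| := by fun_prop
          simpa using (this.tendsto 0).mono_left nhdsWithin_le_nhds
        filter_upwards [hc.eventually (ge_mem_nhds (abs_pos.2 hk))] with ε hε _ using hε
    obtain ⟨ε, hε, hε0⟩ := (hev.and self_mem_nhdsWithin).exists
    replace hε0 : 0 < ε := hε0
    have hΔ : ∀ k : ι ⊕ ι, |(f₀ + ε • f) (Sum.elim u w k)| + |(f₀ - ε • f) (Sum.elim u w k)| =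
        2 * |f₀ (Sum.elim u w k)| +
          2 * ε * if f₀ (Sum.elim u w k) = 0 then |f (Sum.elim u w k)| else 0 := by
      intro k
      simp only [LinearMap.add_apply, LinearMap.sub_apply, LinearMap.smul_apply, smul_eq_mul]
      split_ifs with hk
      · rw [hk, zero_add, zero_sub, abs_neg, abs_mul, abs_of_pos hε0, abs_zero]
        ring
      · rw [abs_add_abs_sub_of_le (hε k hk)]
        ring
    have h1 : ∑ k, (|(f₀ + ε • f) (u k)| + |(f₀ - ε • f) (u k)|) =
        ∑ k, (2 * |f₀ (u k)| + 2 * ε * if f₀ (u k) = 0 then |f (u k)| else 0) :=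
      Finset.sum_congr rfl fun k _ => hΔ (Sum.inl k)
    have h2 : ∑ k, (|(f₀ + ε • f) (w k)| + |(f₀ - ε • f) (w k)|) =
        ∑ k, (2 * |f₀ (w k)| + 2 * ε * if f₀ (w k) = 0 then |f (w k)| else 0) :=
      Finset.sum_congr rfl fun k _ => hΔ (Sum.inr k)
    rw [Finset.sum_add_distrib, Finset.sum_add_distrib, ← Finset.mul_sum, ← Finset.mul_sum]
      at h1 h2
    have h3 : ∑ k, (if f₀ (u k) = 0 then |f (u k)| else 0) = |f (u i)| := by
      simp [hu']
    rw [h3, h, h, h, h2] at h1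
    have h4 : 2 * ε * |f (u i)| = 2 * ε * ∑ j, if f₀ (w j) = 0 then |f (w j)| else 0 := by
      linarith
    exact mul_left_cancel₀ (by positivity) h4
  have hex : ∃ j, f₀ (w j) = 0 := by
    by_contra! hno
    obtain ⟨f, hf⟩ := Projective.exists_dual_ne_zero ℝ (hu0 i)
    have := key f
    simp only [hno, if_false, Finset.sum_const_zero, abs_eq_zero] at this
    exact hf this
  obtain ⟨j, hj⟩ := hex
  -- Two such `w` would both lie on the line of `u i`, against their pairwise independence. Hence `w
  -- j = r • u i`, and `key` forces `|r| = 1`.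
  have hw' : ∀ k, f₀ (w k) = 0 ↔ k = j := by
    refine fun k => ⟨fun hk => ?_, fun hk => hk ▸ hj⟩
    by_contra hkj
    obtain ⟨a, ha⟩ := Submodule.mem_span_singleton.1 (hne (Sum.inr k) hk)
    obtain ⟨b, hb⟩ := Submodule.mem_span_singleton.1 (hne (Sum.inr j) hj)
    simp only [Sum.elim_inr] at ha hb
    have hb0 : b ≠ 0 := by
      rintro rfl
      exact hw0 j (by rw [← hb, zero_smul])
    refine hw j k (Ne.symm hkj) (Submodule.mem_span_singleton.2 ⟨a / b, ?_⟩)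
    rw [← ha, ← hb, smul_smul, div_mul_cancel₀ _ hb0]
  simp only [hw', Finset.sum_ite_eq', Finset.mem_univ, if_true] at key
  obtain ⟨r, hr⟩ := Submodule.mem_span_singleton.1 (hne (Sum.inr j) hj)
  simp only [Sum.elim_inr] at hr
  obtain ⟨f, hf⟩ := Projective.exists_dual_ne_zero ℝ (hu0 i)
  have hk := key f
  rw [← hr, map_smul, smul_eq_mul, abs_mul] at hk
  have hr1 : |r| = 1 := by
    have := abs_pos.2 hf
    nlinarith
  refine ⟨j, ?_⟩
  rcases (abs_eq zero_le_one).1 hr1 with rfl | rfl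
  · exact Or.inl (by rw [← hr, one_smul])
  · exact Or.inr (by rw [← hr, neg_one_smul])

/-- The width of a zonotope in the direction of a linear form. -/
theorem isGreatest_width {d n : ℕ} (c : Fin d → ℝ) (u : Fin n → Fin d → ℝ)
    (f : Module.Dual ℝ (Fin d → ℝ)) :
    IsGreatest {r | ∃ x ∈ zonotope c u, ∃ y ∈ zonotope c u, r = f x - f y} (∑ i, |f (u i)|) := by
  constructor
  · refine ⟨_, ⟨fun i => if 0 ≤ f (u i) then 1 else 0, fun i => ?_, rfl⟩, _,
      ⟨fun i => if 0 ≤ f (u i) then 0 else 1, fun i => ?_, rfl⟩, ?_⟩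
    · dsimp only
      split_ifs <;> simp
    · dsimp only
      split_ifs <;> simp
    · rw [← map_sub, add_sub_add_left_eq_sub, ← Finset.sum_sub_distrib, map_sum]
      refine Finset.sum_congr rfl fun i _ => ?_
      rw [← sub_smul, map_smul]
      beta_reduce
      split_ifs with h
      · simp [abs_of_nonneg h]
      · simp [abs_of_neg (not_le.1 h)]
  · rintro r ⟨x, ⟨l, hl, rfl⟩, y, ⟨m, hm, rfl⟩, rfl⟩
    rw [← map_sub, add_sub_add_left_eq_sub, ← Finset.sum_sub_distrib, map_sum]
    refine Finset.sum_le_sum fun i _ => ?_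
    rw [← sub_smul, map_smul, smul_eq_mul]
    refine (le_abs_self _).trans ?_
    rw [abs_mul]
    refine mul_le_of_le_one_left (abs_nonneg _) (abs_le.2 ?_)
    constructor <;> linarith [(hl i).1, (hl i).2, (hm i).1, (hm i).2]

theorem image_zonotope {d n : ℕ} (M : Matrix (Fin d) (Fin d) ℝ) (t c : Fin d → ℝ)
    (u : Fin n → Fin d → ℝ) :
    (fun x => M.mulVec x + t) '' zonotope c u =
      zonotope (M.mulVec c + t) fun i => M.mulVec (u i) := by
  have e : ∀ l : Fin n → ℝ, M.mulVec (c + ∑ i, l i • u i) + t =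
      M.mulVec c + t + ∑ i, l i • M.mulVec (u i) := by
    intro l
    have := map_sum (Matrix.mulVecLin M) (fun i => l i • u i) Finset.univ
    simp only [Matrix.mulVecLin_apply, Matrix.mulVec_smul] at this
    rw [Matrix.mulVec_add, this]
    abel
  ext x
  constructor
  · rintro ⟨_, ⟨l, hl, rfl⟩, rfl⟩
    exact ⟨l, hl, e l⟩
  · rintro ⟨l, hl, rfl⟩
    exact ⟨_, ⟨l, hl, rfl⟩, e l⟩

/-- Changing signs of generators translates a zonotope. -/
theorem zonotope_signs {d n : ℕ} (c : Fin d → ℝ) (u : Fin n → Fin d → ℝ) (δ : Fin n → ℝ)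
    (hδ : ∀ i, δ i = 1 ∨ δ i = -1) :
    zonotope c u = zonotope (c + ∑ i, ((1 - δ i) / 2) • u i) fun i => δ i • u i := by
  have hb : ∀ l : Fin n → ℝ, (∀ i, l i ∈ Set.Icc (0 : ℝ) 1) →
      ∀ i, (1 - δ i) / 2 + δ i * l i ∈ Set.Icc (0 : ℝ) 1 := by
    intro l hl i
    have := hl i
    rcases hδ i with h | h <;> rw [h] <;> constructor <;> linarith [this.1, this.2]
  have hsq : ∀ i, δ i * δ i = 1 := fun i => by rcases hδ i with h | h <;> rw [h] <;> norm_num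
  ext x
  constructor
  · rintro ⟨l, hl, rfl⟩
    refine ⟨_, hb l hl, ?_⟩
    rw [add_assoc, ← Finset.sum_add_distrib]
    congr 1
    refine Finset.sum_congr rfl fun i _ => ?_
    rw [smul_smul, ← add_smul]
    congr 1
    linear_combination (-l i + 1 / 2) * hsq i
  · rintro ⟨l, hl, rfl⟩
    refine ⟨_, hb l hl, ?_⟩
    rw [add_assoc, ← Finset.sum_add_distrib]
    congr 1
    refine Finset.sum_congr rfl fun i _ => ?_
    rw [smul_smul, ← add_smul]
    congr 1
    ring

/-! ### Primitive volume vectors classify zonotopes up to equivalence -/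

theorem GeneralPosition.notMem_span {U : Fin 4 → Fin 3 → ℤ} (hU : GeneralPosition U)
    {i j : Fin 4} (hij : i ≠ j) : toReal (U j) ∉ Submodule.span ℝ {toReal (U i)} := by
  obtain ⟨k, hki, hkj⟩ : ∃ k, i ≠ k ∧ j ≠ k := by
    revert i j
    decide
  obtain ⟨i', rfl⟩ := Fin.exists_succAbove_eq hki
  obtain ⟨j', rfl⟩ := Fin.exists_succAbove_eq hkj
  have := (hU k).notMem_span_image (s := {i'}) (x := j')
    (fun h => hij (by rw [Set.mem_singleton_iff.1 h]))
  rwa [Set.image_singleton] at this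

theorem GeneralPosition.ne_zero {U : Fin 4 → Fin 3 → ℤ} (hU : GeneralPosition U) (i : Fin 4) :
    toReal (U i) ≠ 0 := by
  intro h
  obtain ⟨j, hj⟩ := exists_ne i
  exact hU.notMem_span hj (h ▸ Submodule.zero_mem _)

/-- The linear relations of `4` vectors of `ℝ^3` in general position are multiples of each
other. -/
theorem GeneralPosition.exists_smul_eq {U : Fin 4 → Fin 3 → ℤ} (hU : GeneralPosition U)
    {x y : Fin 4 → ℝ} (hx : ∑ i, x i • toReal (U i) = 0) (hy : ∑ i, y i • toReal (U i) = 0)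
    (hx0 : x 0 ≠ 0) : ∃ r : ℝ, y = r • x := by
  refine ⟨y 0 / x 0, ?_⟩
  have h : ∑ j : Fin 3, (y j.succ - y 0 / x 0 * x j.succ) •
      toReal (U ((0 : Fin 4).succAbove j)) = 0 := by
    rw [Fin.sum_univ_succ] at hx hy
    simp only [Fin.succAbove_zero, sub_smul, mul_smul, Finset.sum_sub_distrib, ← Finset.smul_sum]
    rw [eq_neg_of_add_eq_zero_right hx, eq_neg_of_add_eq_zero_right hy, smul_neg, smul_smul,
      div_mul_cancel₀ _ hx0]
    abel
  have h' := Fintype.linearIndependent_iff.1 (hU 0) _ h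
  funext i
  refine Fin.cases ?_ (fun j => ?_) i
  · rw [Pi.smul_apply, smul_eq_mul, div_mul_cancel₀ _ hx0]
  · rw [Pi.smul_apply, smul_eq_mul]
    linarith [h' j]

/-- The adjugate gives integer coefficients of `det • x` in terms of three of the generators. -/
theorem det_smul_mem_span (U : Fin 4 → Fin 3 → ℤ) (i : Fin 4) (x : Fin 3 → ℤ) :
    volumeVector U i • x ∈ Submodule.span ℤ (Set.range U) := by
  have h : (Matrix.of fun j : Fin 3 => U (i.succAbove j)).det • x ∈
      Submodule.span ℤ (Set.range U) := by
    set M := Matrix.of fun j : Fin 3 => U (i.succAbove j)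
    have e : M.det • x = Matrix.vecMul (Matrix.vecMul x M.adjugate) M := by
      rw [Matrix.vecMul_vecMul, Matrix.adjugate_mul, Matrix.vecMul_smul, Matrix.vecMul_one]
    rw [e, Matrix.vecMul_eq_sum]
    exact Submodule.sum_mem _ fun j _ => Submodule.smul_mem _ _
      (Submodule.subset_span ⟨i.succAbove j, rfl⟩)
  rw [volumeVector]
  rcases abs_choice (Matrix.of fun j : Fin 3 => U (i.succAbove j)).det with h' | h' <;> rw [h']
  · exact h
  · rw [neg_smul]
    exact Submodule.neg_mem _ h

/-- If the entries of the volume vector are coprime, the generators span `ℤ^3`. -/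
theorem exists_int_coeff {U : Fin 4 → Fin 3 → ℤ}
    (hgcd : Finset.univ.gcd (volumeVector U) = 1) (x : Fin 3 → ℤ) :
    ∃ n : Fin 4 → ℤ, x = ∑ i, n i • U i := by
  obtain ⟨z, hz⟩ := exists_bezout_four (volumeVector U)
  have hg : ((Nat.gcd (Nat.gcd (volumeVector U 0).natAbs (volumeVector U 1).natAbs)
      (Nat.gcd (volumeVector U 2).natAbs (volumeVector U 3).natAbs) : ℕ) : ℤ) ∣ 1 := by
    rw [← hgcd]
    refine Finset.dvd_gcd fun i _ => ?_
    rw [Int.natCast_dvd]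
    fin_cases i
    exacts [(Nat.gcd_dvd_left _ _).trans (Nat.gcd_dvd_left _ _),
      (Nat.gcd_dvd_left _ _).trans (Nat.gcd_dvd_right _ _),
      (Nat.gcd_dvd_right _ _).trans (Nat.gcd_dvd_left _ _),
      (Nat.gcd_dvd_right _ _).trans (Nat.gcd_dvd_right _ _)]
  rw [Int.eq_one_of_dvd_one (by positivity) hg] at hz
  have hx : x ∈ Submodule.span ℤ (Set.range U) := by
    have : x = ∑ i, z i • (volumeVector U i • x) := by
      simp only [smul_smul, ← Finset.sum_smul]
      rw [Finset.sum_congr rfl fun i _ => mul_comm (z i) _, hz, one_smul]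
    rw [this]
    exact Submodule.sum_mem _ fun i _ => Submodule.smul_mem _ _ (det_smul_mem_span U i x)
  obtain ⟨n, hn⟩ := (Submodule.mem_span_range_iff_exists_fun ℤ).1 hx
  exact ⟨n, hn.symm⟩

theorem volumeVector_ne_zero {U : Fin 4 → Fin 3 → ℤ} (hU : GeneralPosition U) (i : Fin 4) :
    volumeVector U i ≠ 0 := by
  rw [volumeVector, abs_ne_zero]
  intro h
  have hr : ((Matrix.of fun j : Fin 3 => U (i.succAbove j)).map (Int.castRingHom ℝ)).det = 0 := by
    rw [← RingHom.mapMatrix_apply, ← RingHom.map_det, h, map_zero]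
  obtain ⟨x, hx0, hx⟩ := Matrix.exists_vecMul_eq_zero_iff.2 hr
  rw [Matrix.vecMul_eq_sum] at hx
  exact hx0 (funext (Fintype.linearIndependent_iff.1 (hU i) x hx))

/-- Two families with the same primitive volume vector are related, up to signs, by an integer
matrix. -/
theorem exists_matrix {U U' : Fin 4 → Fin 3 → ℤ} (hU : GeneralPosition U)
    (hgcd : Finset.univ.gcd (volumeVector U) = 1) {δ : Fin 4 → ℤ} {e e' : Fin 4 → ℤ}
    (he0 : e 0 ≠ 0) (he : ∑ i, e i • U i = 0)
    (he' : ∑ i, e' i • U' i = 0) (hδ : ∀ i, e i * δ i = e' i) :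
    ∃ A : Matrix (Fin 3) (Fin 3) ℤ, ∀ i, A.mulVec (U i) = δ i • U' i := by
  -- The map sending `∑ n i • U i` to `∑ (n i * δ i) • U' i` is well defined: every relation of `U`
  -- is a real multiple of `e`, and twisting by `δ` turns it into a multiple of the relation `e'` of
  -- `U'`.
  have wd : ∀ n : Fin 4 → ℤ, ∑ i, n i • U i = 0 → ∑ i, (n i * δ i) • U' i = 0 := by
    intro n hn
    have cast0 : ∀ (m : Fin 4 → ℤ) (V : Fin 4 → Fin 3 → ℤ), ∑ i, m i • V i = 0 →
        ∑ i, (m i : ℝ) • toReal (V i) = 0 := fun m V hm => by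
      rw [← toReal_sum_smul, hm]
      funext k
      simp [toReal]
    obtain ⟨r, hr⟩ := hU.exists_smul_eq (x := fun i => (e i : ℝ)) (y := fun i => (n i : ℝ))
      (cast0 e U he) (cast0 n U hn) (by exact_mod_cast he0)
    have h1 : ∀ i, ((n i * δ i : ℤ) : ℝ) = r * e' i := by
      intro i
      have := congrFun hr i
      simp only [Pi.smul_apply, smul_eq_mul] at this
      rw [← hδ i]
      push_cast
      rw [this]
      ring
    have h2 : toReal (∑ i, (n i * δ i) • U' i) = 0 := by
      rw [toReal_sum_smul]
      simp only [h1, mul_smul, ← Finset.smul_sum]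
      rw [cast0 e' U' he', smul_zero]
    funext k
    have := congrFun h2 k
    simp only [toReal, Pi.zero_apply] at this
    exact_mod_cast this
  choose n hn using fun x => exists_int_coeff hgcd x
  have wd2 : ∀ x (m : Fin 4 → ℤ), x = ∑ i, m i • U i →
      ∑ i, (n x i * δ i) • U' i = ∑ i, (m i * δ i) • U' i := by
    intro x m hm
    rw [← sub_eq_zero, ← Finset.sum_sub_distrib]
    have := wd (fun i => n x i - m i) (by
      simp only [sub_smul, Finset.sum_sub_distrib]
      rw [← hm, ← hn x, sub_self])
    simpa only [sub_mul, sub_smul] using this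
  let f : (Fin 3 → ℤ) →ₗ[ℤ] (Fin 3 → ℤ) :=
    { toFun := fun x => ∑ i, (n x i * δ i) • U' i
      map_add' := fun x y => by
        rw [wd2 (x + y) (fun i => n x i + n y i) (by
          simp only [add_smul, Finset.sum_add_distrib]
          rw [← hn, ← hn])]
        simp only [add_mul, add_smul, Finset.sum_add_distrib]
      map_smul' := fun r x => by
        rw [wd2 (r • x) (fun i => r * n x i) (by
          simp only [mul_smul, ← Finset.smul_sum]
          rw [← hn])]
        simp only [mul_assoc, mul_smul, ← Finset.smul_sum, RingHom.id_apply] }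
  refine ⟨LinearMap.toMatrix' f, fun i => ?_⟩
  rw [LinearMap.toMatrix'_mulVec]
  change ∑ j, (n (U i) j * δ j) • U' j = δ i • U' i
  rw [wd2 (U i) (Pi.single i 1) (by simp [Pi.single_apply])]
  simp [Pi.single_apply]

theorem toReal_mulVec (A : Matrix (Fin 3) (Fin 3) ℤ) (x : Fin 3 → ℤ) :
    (A.map (Int.cast : ℤ → ℝ)).mulVec (toReal x) = toReal (A.mulVec x) := by
  funext k
  simp [Matrix.mulVec, dotProduct, toReal]

/-- The matrices from `exists_matrix` in both directions use the same signs, so `B * A` fixes the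
generators. These span `ℤ^3`, so `A` is unimodular, and the signs are absorbed in the translation.
-/
theorem unimodularEquiv_of_volumeVector_eq {U U' : Fin 4 → Fin 3 → ℤ} (hU : GeneralPosition U)
    (hU' : GeneralPosition U') (hgcd : Finset.univ.gcd (volumeVector U) = 1)
    (h : volumeVector U = volumeVector U') (c c' : Fin 3 → ℝ) :
    UnimodularEquiv (zonotope c fun i => toReal (U i)) (zonotope c' fun i => toReal (U' i)) := by
  obtain ⟨ε, hε, hr⟩ := exists_signs U
  obtain ⟨ε', hε', hr'⟩ := exists_signs U'
  have hne : ∀ i, ε i ≠ 0 := fun i h0 => by have := hε i; rw [h0] at this; omega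
  have hne' : ∀ i, ε' i ≠ 0 := fun i h0 => by have := hε' i; rw [h0] at this; omega
  have hδ : ∀ i, (ε i * ε' i) * (ε i * ε' i) = 1 := fun i => by
    linear_combination ε' i * ε' i * hε i + hε' i
  obtain ⟨A, hA⟩ := exists_matrix (U' := U') hU hgcd (δ := fun i => ε i * ε' i)
    (mul_ne_zero (hne 0) (volumeVector_ne_zero hU 0)) hr hr' fun i => by
      rw [h]
      linear_combination ε' i * volumeVector U' i * hε i
  obtain ⟨B, hB⟩ := exists_matrix (U' := U) hU' (h ▸ hgcd) (δ := fun i => ε i * ε' i)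
    (mul_ne_zero (hne' 0) (volumeVector_ne_zero hU' 0)) hr' hr fun i => by
      rw [h]
      linear_combination ε i * volumeVector U' i * hε' i
  have hBA : B * A = 1 := by
    apply Matrix.ext_of_mulVec_single
    intro k
    obtain ⟨n, hn⟩ := exists_int_coeff hgcd (Pi.single k 1)
    have hi : ∀ i, (B * A).mulVec (U i) = U i := fun i => by
      rw [← Matrix.mulVec_mulVec, hA, Matrix.mulVec_smul, hB, smul_smul, hδ, one_smul]
    have hs := map_sum (Matrix.mulVecLin (B * A)) (fun i => n i • U i) Finset.univ
    simp only [Matrix.mulVecLin_apply, Matrix.mulVec_smul, hi] at hs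
    rw [hn, hs, Matrix.one_mulVec]
  have hdet : IsUnit A.det := by
    rw [← Matrix.isUnit_iff_isUnit_det]
    exact IsUnit.of_mul_eq_one_right _ hBA
  have hδ' : ∀ i, ((ε i * ε' i : ℤ) : ℝ) = 1 ∨ ((ε i * ε' i : ℤ) : ℝ) = -1 := fun i => by
    rcases mul_self_eq_one_iff.1 (hδ i) with h | h <;> rw [h] <;> simp
  refine ⟨A, c' + ∑ i, ((1 - ((ε i * ε' i : ℤ) : ℝ)) / 2) • toReal (U' i) -
    (A.map (Int.cast : ℤ → ℝ)).mulVec c, Int.isUnit_iff.1 hdet, ?_⟩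
  rw [image_zonotope, add_sub_cancel, zonotope_signs c' _ _ hδ']
  congr 1
  funext i
  rw [toReal_mulVec, hA]
  funext k
  simp [toReal]

/-- Equal zonotopes have equal widths, so `A` matches the generators up to sign and a permutation.
Relations then correspond, making the volume vectors proportional after the permutation;
monotonicity makes it the identity and primitivity makes the factor `1`. -/
theorem volumeVector_eq_of_unimodularEquiv {U U' : Fin 4 → Fin 3 → ℤ} (hU : GeneralPosition U)
    (hU' : GeneralPosition U') (hm : StrictMono (volumeVector U))
    (hm' : StrictMono (volumeVector U'))
    (hgcd : Finset.univ.gcd (volumeVector U) = 1) (hgcd' : Finset.univ.gcd (volumeVector U') = 1)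
    {c c' : Fin 3 → ℝ}
    (h : UnimodularEquiv (zonotope c fun i => toReal (U i))
      (zonotope c' fun i => toReal (U' i))) : volumeVector U = volumeVector U' := by
  obtain ⟨A, t, hdet, hZ⟩ := h
  rw [image_zonotope] at hZ
  set M := A.map (Int.cast : ℤ → ℝ) with hM
  have hMdet : M.det ≠ 0 := by
    have : M.det = (A.det : ℝ) := (RingHom.map_det (Int.castRingHom ℝ) A).symm
    rw [this]
    rcases hdet with h | h <;> rw [h] <;> norm_num
  have hinj : Function.Injective M.mulVecLin := by
    rw [injective_iff_map_eq_zero]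
    exact fun x hx => Matrix.eq_zero_of_mulVec_eq_zero hMdet hx
  have key := exists_eq_or_neg_of_sum_abs_eq (u := fun i => toReal (U' i))
    (w := fun i => M.mulVec (toReal (U i))) hU'.ne_zero
    (fun i h0 => hU.ne_zero i (Matrix.eq_zero_of_mulVec_eq_zero hMdet h0))
    (fun i j hij => hU'.notMem_span hij)
    (fun i j hij hmem => by
      obtain ⟨r, hr⟩ := Submodule.mem_span_singleton.1 hmem
      refine hU.notMem_span hij (Submodule.mem_span_singleton.2 ⟨r, hinj ?_⟩)
      rw [map_smul]
      exact hr)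
    (fun f => by
      have h1 := isGreatest_width c' (fun i => toReal (U' i)) f
      rw [hZ] at h1
      exact h1.unique (isGreatest_width _ _ f))
  have key' : ∀ i, ∃ j, ∃ s : ℝ, (s = 1 ∨ s = -1) ∧
      toReal (U' i) = s • M.mulVec (toReal (U j)) := by
    intro i
    obtain ⟨j, hj | hj⟩ := key i
    · exact ⟨j, 1, Or.inl rfl, by rw [one_smul, hj]⟩
    · exact ⟨j, -1, Or.inr rfl, by rw [hj]; simp⟩
  choose σ s hs hσ using key'
  have hs0 : ∀ i, s i ≠ 0 := fun i => by rcases hs i with h | h <;> rw [h] <;> norm_num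
  have hs1 : ∀ i, |s i| = 1 := fun i => by rcases hs i with h | h <;> rw [h] <;> norm_num
  have hσinj : Function.Injective σ := by
    intro i j hij
    by_contra hne
    refine hU'.notMem_span hne (Submodule.mem_span_singleton.2 ⟨s j / s i, ?_⟩)
    rw [hσ i, hσ j, hij, smul_smul, div_mul_cancel₀ _ (hs0 i)]
  let τ : Equiv.Perm (Fin 4) := Equiv.ofBijective σ (Finite.injective_iff_bijective.1 hσinj)
  have hτ : ∀ i, σ (τ.symm i) = i := fun i => τ.apply_symm_apply i
  obtain ⟨ε, hε, hr⟩ := exists_signs U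
  obtain ⟨ε', hε', hr'⟩ := exists_signs U'
  have habs : ∀ (ε : Fin 4 → ℤ), (∀ i, ε i * ε i = 1) → ∀ i, |(ε i : ℝ)| = 1 := by
    intro ε hε i
    rcases mul_self_eq_one_iff.1 (hε i) with h | h <;> rw [h] <;> norm_num
  have cast0 : ∀ (m : Fin 4 → ℤ) (V : Fin 4 → Fin 3 → ℤ), ∑ i, m i • V i = 0 →
      ∑ i, (m i : ℝ) • toReal (V i) = 0 := fun m V hm => by
    rw [← toReal_sum_smul, hm]
    funext k
    simp [toReal]
  have hrel := cast0 _ _ hr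
  have hrel' := cast0 _ _ hr'
  -- The relation of `U'`, rewritten in the vectors `M (U j)` and pulled back through the injective
  -- `M`.
  have hrel2 : ∑ i, (((ε' (τ.symm i) * volumeVector U' (τ.symm i) : ℤ) : ℝ) * s (τ.symm i)) •
      toReal (U i) = 0 := by
    apply hinj
    rw [map_zero, map_sum, ← hrel', ← Equiv.sum_comp τ.symm
      (fun i => ((ε' i * volumeVector U' i : ℤ) : ℝ) • toReal (U' i))]
    refine Finset.sum_congr rfl fun i _ => ?_
    rw [hσ (τ.symm i), hτ, map_smul, smul_smul]
    rfl
  have hne0 : ((ε 0 * volumeVector U 0 : ℤ) : ℝ) ≠ 0 := by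
    refine Int.cast_ne_zero.2 (mul_ne_zero (fun h0 => ?_) (volumeVector_ne_zero hU 0))
    have := hε 0
    rw [h0] at this
    omega
  obtain ⟨r, hr2⟩ := hU.exists_smul_eq hrel hrel2 hne0
  have hpos : ∀ (V : Fin 4 → Fin 3 → ℤ) i, (0 : ℝ) ≤ volumeVector V i := fun V i => by
    exact_mod_cast abs_nonneg _
  have hprop : ∀ i, (volumeVector U' i : ℝ) = |r| * volumeVector U (σ i) := by
    intro i
    have h1 := congrFun hr2 (σ i)
    have h2 : τ.symm (σ i) = i := τ.symm_apply_apply i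
    simp only [h2, Pi.smul_apply, smul_eq_mul] at h1
    have h3 := congrArg abs h1
    push_cast at h3
    rw [abs_mul, abs_mul, abs_mul, abs_mul, habs ε hε, habs ε' hε', hs1, abs_of_nonneg (hpos U' i),
      abs_of_nonneg (hpos U _)] at h3
    linarith
  have hσmono : StrictMono σ := by
    intro i j hij
    have h1 : (volumeVector U' i : ℝ) < volumeVector U' j := by exact_mod_cast hm' hij
    rw [hprop, hprop] at h1
    have h2 : (volumeVector U (σ i) : ℝ) < volumeVector U (σ j) :=
      lt_of_mul_lt_mul_left h1 (abs_nonneg r)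
    exact hm.lt_iff_lt.1 (by exact_mod_cast h2)
  have hσid : σ = id := hσmono.eq_id
  have hcross : ∀ i, volumeVector U' 0 * volumeVector U i =
      volumeVector U 0 * volumeVector U' i := by
    intro i
    have h1 := hprop i
    have h2 := hprop 0
    rw [hσid, id] at h1 h2
    have : (volumeVector U' 0 : ℝ) * volumeVector U i = volumeVector U 0 * volumeVector U' i := by
      rw [h1, h2]
      ring
    exact_mod_cast this
  have h0 : volumeVector U' 0 = volumeVector U 0 := by
    have h1 : Finset.univ.gcd (fun i => volumeVector U' 0 * volumeVector U i) =
        Finset.univ.gcd (fun i => volumeVector U 0 * volumeVector U' i) := by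
      simp only [hcross]
    rw [Finset.gcd_mul_left, Finset.gcd_mul_left, hgcd, hgcd', mul_one, mul_one,
      Int.normalize_of_nonneg (show 0 ≤ volumeVector U' 0 from abs_nonneg _),
      Int.normalize_of_nonneg (show 0 ≤ volumeVector U 0 from abs_nonneg _)] at h1
    exact h1
  funext i
  have := hcross i
  rw [h0] at this
  exact mul_left_cancel₀ (volumeVector_ne_zero hU 0) this

/-! ### Every positive vector is a volume vector -/

theorem generalPosition_of_volumeVector_ne_zero {U : Fin 4 → Fin 3 → ℤ}
    (h : ∀ i, volumeVector U i ≠ 0) : GeneralPosition U := by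
  intro i
  have h1 : ((Matrix.of fun j => U (i.succAbove j)).map (Int.castRingHom ℝ)).det ≠ 0 := by
    rw [← RingHom.mapMatrix_apply, ← RingHom.map_det]
    exact Int.cast_ne_zero.2 (abs_ne_zero.1 (h i))
  exact Matrix.linearIndependent_rows_of_det_ne_zero h1

theorem bezout_factor {m n : ℤ} (hm : 0 < m) (hn : 0 < n) : ∃ g a b x y : ℤ,
    0 < g ∧ m = g * a ∧ n = g * b ∧ 0 < a ∧ 0 < b ∧ x * a + y * b = 1 := by
  have hg : (0 : ℤ) < Int.gcd m n := by exact_mod_cast Int.gcd_pos_of_ne_zero_left n hm.ne'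
  obtain ⟨a, ha⟩ := Int.gcd_dvd_left m n
  obtain ⟨b, hb⟩ := Int.gcd_dvd_right m n
  refine ⟨Int.gcd m n, a, b, Int.gcdA m n, Int.gcdB m n, hg, ha, hb,
    (mul_pos_iff_of_pos_left hg).1 (ha ▸ hm), (mul_pos_iff_of_pos_left hg).1 (hb ▸ hn), ?_⟩
  have h := Int.gcd_eq_gcd_ab m n
  refine mul_left_cancel₀ hg.ne' ?_
  linear_combination -h - Int.gcdA m n * ha - Int.gcdB m n * hb

/-- Every vector of positive integers is a volume vector: a basis of the lattice of integer
relations with these coefficients is written down from Bézout identities. -/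
theorem exists_volumeVector_eq {v : Fin 4 → ℤ} (hv : ∀ i, 0 < v i) :
    ∃ U : Fin 4 → Fin 3 → ℤ, volumeVector U = v := by
  obtain ⟨g, a, b, x, y, hg, ha, hb, ha0, hb0, hxy⟩ : ∃ g a b x y : ℤ, 0 < g ∧ v 0 = g * a ∧
      v 1 = g * b ∧ 0 < a ∧ 0 < b ∧ x * a + y * b = 1 := bezout_factor (hv 0) (hv 1)
  obtain ⟨h, p, q, u, w, hh, hp, hq, hp0, hq0, huw⟩ : ∃ h p q u w : ℤ, 0 < h ∧ g = h * p ∧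
      v 2 = h * q ∧ 0 < p ∧ 0 < q ∧ u * p + w * q = 1 := bezout_factor hg (hv 2)
  -- The three columns are orthogonal to `v` and triangular in shape: the relation of `v 0`, `v 1`,
  -- then one bringing in `v 2`, then one bringing in `v 3`, with pivots `b, -a`, then `-p`, then
  -- `-h`. The generators are the rows.
  refine ⟨![![b, q * x, v 3 * x * u], ![-a, q * y, v 3 * y * u], ![0, -p, v 3 * w],
    ![0, 0, -h]], ?_⟩
  have h3 := hv 3
  have e0 : v 0 = h * p * a := by rw [ha, hp]
  have e1 : v 1 = h * p * b := by rw [hb, hp]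
  funext i
  fin_cases i
  · simp only [volumeVector, Matrix.det_fin_three, Fin.succAbove]
    simp [abs_of_pos, *]
    ring
  · simp only [volumeVector, Matrix.det_fin_three, Fin.succAbove]
    simp [abs_of_pos, *]
    ring
  · refine (congrArg abs (?_ : _ = -v 2)).trans (by rw [abs_neg, abs_of_pos (hv 2)]; rfl)
    simp [Matrix.det_fin_three, Fin.succAbove]
    linear_combination hq - h * q * hxy
  · refine (congrArg abs (?_ : _ = v 3)).trans (abs_of_pos h3)
    simp [Matrix.det_fin_three, Fin.succAbove]
    linear_combination v 3 * (x * a + y * b) * huw + v 3 * hxy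

theorem exists_isSLRZonotope {v : Fin 4 → ℤ} (hv : ∀ i, 0 < v i) (hinj : Function.Injective v) :
    ∃ Z : Set (Fin 3 → ℝ), IsSLRZonotope Z v := by
  obtain ⟨U, hU⟩ := exists_volumeVector_eq hv
  exact ⟨_, U, generalPosition_of_volumeVector_ne_zero fun i => hU ▸ (hv i).ne', hU, hinj, 0, rfl⟩

/-! ### Counting the volume vectors -/

/-- The sum of `f i` for `i < n`. -/
def sumBelow (n : ℕ) (f : ℕ → ℕ) : ℕ := Nat.rec 0 (fun i r => f i + r) n

theorem sumBelow_eq (n : ℕ) (f : ℕ → ℕ) : sumBelow n f = ∑ i ∈ Finset.range n, f i := by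
  induction n with
  | zero => rfl
  | succ n ih =>
    rw [Finset.sum_range_succ, ← ih]
    exact Nat.add_comm _ _

/-- The number of `d` with `c < d ≤ c + m` that are coprime to `g`. -/
def coprimeCount (g c m : ℕ) : ℕ :=
  bif Nat.beq g 1 then m else
    sumBelow m fun l => bif Nat.beq (Nat.gcd g (c + 1 + l)) 1 then 1 else 0

theorem beq_eq_false_of_ne {m n : ℕ} (h : m ≠ n) : Nat.beq m n = false :=
  Bool.eq_false_iff.2 fun h' => h (Nat.eq_of_beq_eq_true h')

theorem coprimeCount_eq (g c m : ℕ) : coprimeCount g c m =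
    ((Finset.range m).filter fun l => Nat.gcd g (c + 1 + l) = 1).card := by
  unfold coprimeCount
  by_cases hg : g = 1
  · subst hg
    simp
  · rw [beq_eq_false_of_ne hg, cond_false, sumBelow_eq, Finset.card_filter]
    refine Finset.sum_congr rfl fun l _ => ?_
    by_cases h : Nat.gcd g (c + 1 + l) = 1
    · simp [h]
    · have : Nat.beq (Nat.gcd g (c + 1 + l)) 1 = false := beq_eq_false_of_ne h
      simp [h, this]

/-- The number of primitive quadruples `a < b < c < d` with sum at most `195`. -/
def quadrupleCount : ℕ :=
  -- The ranges come from the smallest possible sums: `4 a + 6 ≤ 195`, `a + 3 b + 3 ≤ 195` and `a +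
  -- b + 2 c + 1 ≤ 195`.
  sumBelow 47 fun i => withNat (i + 1) fun a =>
    sumBelow ((192 - a) / 3 - a) fun j => withNat (a + 1 + j) fun b =>
      sumBelow ((194 - a - b) / 2 - b) fun k => withNat (b + 1 + k) fun c =>
        withNat (Nat.gcd (Nat.gcd a b) c) fun g => coprimeCount g c (195 - a - b - c - c)

set_option maxRecDepth 100000 in
theorem quadrupleCount_eq : quadrupleCount = 2133561 := by decide +kernel

/-- The primitive quadruples `a < b < c < d` with sum at most `195`, parametrized by
`a - 1`, `b - a - 1`, `c - b - 1` and `d - c - 1`. -/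
def quadruples : Finset (Σ _ : ℕ, Σ _ : ℕ, Σ _ : ℕ, ℕ) :=
  (Finset.range 47).sigma fun i => (Finset.range ((192 - (i + 1)) / 3 - (i + 1))).sigma fun j =>
    (Finset.range ((194 - (i + 1) - (i + 1 + 1 + j)) / 2 - (i + 1 + 1 + j))).sigma fun k =>
      (Finset.range (195 - (i + 1) - (i + 1 + 1 + j) - (i + 1 + 1 + j + 1 + k) -
        (i + 1 + 1 + j + 1 + k))).filter fun l =>
        Nat.gcd (Nat.gcd (Nat.gcd (i + 1) (i + 1 + 1 + j)) (i + 1 + 1 + j + 1 + k))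
          (i + 1 + 1 + j + 1 + k + 1 + l) = 1

theorem card_quadruples : quadruples.card = 2133561 := by
  rw [← quadrupleCount_eq]
  simp only [quadruples, quadrupleCount, Finset.card_sigma, sumBelow_eq, withNat_eq,
    coprimeCount_eq]

/-- The vector of the quadruple with the given parameters. -/
def quadrupleVector (s : Σ _ : ℕ, Σ _ : ℕ, Σ _ : ℕ, ℕ) : Fin 4 → ℤ :=
  ![s.1 + 1, s.1 + 1 + 1 + s.2.1, s.1 + 1 + 1 + s.2.1 + 1 + s.2.2.1,
    s.1 + 1 + 1 + s.2.1 + 1 + s.2.2.1 + 1 + s.2.2.2]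

theorem quadrupleVector_injective : Function.Injective quadrupleVector := by
  rintro ⟨i, j, k, l⟩ ⟨i', j', k', l'⟩ h
  have h0 := congrFun h 0
  have h1 := congrFun h 1
  have h2 := congrFun h 2
  have h3 := congrFun h 3
  simp [quadrupleVector] at h0 h1 h2 h3
  obtain rfl : i = i' := by omega
  obtain rfl : j = j' := by omega
  obtain rfl : k = k' := by omega
  obtain rfl : l = l' := by omega
  rfl

theorem gcd_vec_eq_one_iff (a b c d : ℕ) :
    Finset.univ.gcd ![(a : ℤ), b, c, d] = 1 ↔ Nat.gcd (Nat.gcd (Nat.gcd a b) c) d = 1 := by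
  have h : Finset.univ.gcd ![(a : ℤ), b, c, d] = (Nat.gcd (Nat.gcd (Nat.gcd a b) c) d : ℕ) := by
    have : (Finset.univ : Finset (Fin 4)) = {0, 1, 2, 3} := rfl
    rw [this, Finset.gcd_insert, Finset.gcd_insert, Finset.gcd_insert, Finset.gcd_singleton]
    simp [Nat.gcd_assoc, ← Int.coe_gcd, Int.normalize_of_nonneg]
  rw [h, Nat.cast_eq_one]

theorem mem_volumeVectors195_iff (a b c d : ℕ) : ![(a : ℤ), b, c, d] ∈ volumeVectors195 ↔
    0 < a ∧ a < b ∧ b < c ∧ c < d ∧ Nat.gcd (Nat.gcd (Nat.gcd a b) c) d = 1 ∧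
      a + b + c + d ≤ 195 := by
  simp only [volumeVectors195, Set.mem_ofPred_eq, gcd_vec_eq_one_iff, Fin.sum_univ_four]
  simp
  omega

theorem exists_nat_of_mem {v : Fin 4 → ℤ} (hv : v ∈ volumeVectors195) :
    ∃ a b c d : ℕ, v = ![(a : ℤ), b, c, d] := by
  obtain ⟨h0, h1, h2, h3, -⟩ := hv
  refine ⟨(v 0).toNat, (v 1).toNat, (v 2).toNat, (v 3).toNat, ?_⟩
  funext i
  fin_cases i <;> simp <;> omega

theorem quadrupleVector_mem_iff (s : Σ _ : ℕ, Σ _ : ℕ, Σ _ : ℕ, ℕ) :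
    quadrupleVector s ∈ volumeVectors195 ↔ s ∈ quadruples := by
  obtain ⟨i, j, k, l⟩ := s
  have h := mem_volumeVectors195_iff (i + 1) (i + 1 + 1 + j) (i + 1 + 1 + j + 1 + k)
    (i + 1 + 1 + j + 1 + k + 1 + l)
  push_cast at h
  refine h.trans ?_
  simp only [quadruples, Finset.mem_sigma, Finset.mem_filter, Finset.mem_range]
  constructor
  · rintro ⟨-, -, -, -, hg, hs⟩
    exact ⟨by omega, by omega, by omega, by omega, hg⟩
  · rintro ⟨-, -, -, hl, hg⟩
    exact ⟨by omega, by omega, by omega, by omega, hg, by omega⟩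

attribute [irreducible] quadruples

theorem volumeVectors195_eq_image : volumeVectors195 = quadrupleVector '' quadruples := by
  ext v
  rw [Set.mem_image]
  constructor
  · intro hv
    obtain ⟨a, b, c, d, rfl⟩ := exists_nat_of_mem hv
    have h := (mem_volumeVectors195_iff a b c d).1 hv
    have h1 : quadrupleVector ⟨a - 1, b - a - 1, c - b - 1, d - c - 1⟩ =
        ![(a : ℤ), b, c, d] := by
      funext n
      fin_cases n <;> simp [quadrupleVector] <;> omega
    exact ⟨_, Finset.mem_coe.2 ((quadrupleVector_mem_iff _).1 (by rwa [h1])), h1⟩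
  · rintro ⟨s, hs, rfl⟩
    exact (quadrupleVector_mem_iff s).2 (Finset.mem_coe.1 hs)

theorem ncard_volumeVectors195 : volumeVectors195.ncard = 2133561 := by
  rw [volumeVectors195_eq_image, Set.ncard_image_of_injective _ quadrupleVector_injective,
    Set.ncard_coe_finset, card_quadruples]

theorem strictMono_of_mem {v : Fin 4 → ℤ} (hv : v ∈ volumeVectors195) : StrictMono v := by
  refine Fin.strictMono_iff_lt_succ.2 fun i => ?_
  fin_cases i
  exacts [hv.2.1, hv.2.2.1, hv.2.2.2.1]

theorem pos_of_mem {v : Fin 4 → ℤ} (hv : v ∈ volumeVectors195) (i : Fin 4) : 0 < v i :=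
  (zero_lt_one.trans_le hv.1).trans_le ((strictMono_of_mem hv).monotone (Fin.zero_le i))

theorem meetsCube_of_mem {v : Fin 4 → ℤ} (hv : v ∈ volumeVectors195) : MeetsCube v := by
  obtain ⟨a, b, c, d, rfl⟩ := exists_nat_of_mem hv
  obtain ⟨ha, hab, hbc, hcd, hg, hs⟩ := (mem_volumeVectors195_iff a b c d).1 hv
  exact meetsCube_of_sum_le ha hab hbc hcd (by rwa [Nat.gcd_assoc] at hg) hs

end LonelyRunner

/-- The four claims: the number of volume vectors; each of them is the volume vector of an sLR
`3`-zonotope; equivalence classes of these zonotopes correspond to the vectors (so there are also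
`2133561` of them); and the covering radius, which is attained as a smallest covering dilation
factor, is at most `3/5` for every one of these zonotopes. -/
theorem theorem4p1 :
    LonelyRunner.volumeVectors195.ncard = 2133561 ∧
    (∀ v ∈ LonelyRunner.volumeVectors195,
      ∃ Z : Set (Fin 3 → ℝ), LonelyRunner.IsSLRZonotope Z v) ∧
    (∀ v ∈ LonelyRunner.volumeVectors195, ∀ v' ∈ LonelyRunner.volumeVectors195,
      ∀ Z Z' : Set (Fin 3 → ℝ),
        LonelyRunner.IsSLRZonotope Z v → LonelyRunner.IsSLRZonotope Z' v' →
          (LonelyRunner.UnimodularEquiv Z Z' ↔ v = v')) ∧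
    (∀ v ∈ LonelyRunner.volumeVectors195, ∀ Z : Set (Fin 3 → ℝ),
      LonelyRunner.IsSLRZonotope Z v →
        IsLeast (LonelyRunner.coveringDilations Z) (LonelyRunner.coveringRadius Z) ∧
        LonelyRunner.coveringRadius Z ≤ 3 / 5) := by
  refine ⟨LonelyRunner.ncard_volumeVectors195, fun v hv =>
    LonelyRunner.exists_isSLRZonotope (LonelyRunner.pos_of_mem hv)
      (LonelyRunner.strictMono_of_mem hv).injective, ?_, ?_⟩
  · rintro _ hv _ hv' _ _ ⟨U, hU, rfl, -, c, rfl⟩ ⟨U', hU', rfl, -, c', rfl⟩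
    have hgcd := hv.2.2.2.2.1
    have hgcd' := hv'.2.2.2.2.1
    exact ⟨LonelyRunner.volumeVector_eq_of_unimodularEquiv hU hU'
      (LonelyRunner.strictMono_of_mem hv) (LonelyRunner.strictMono_of_mem hv') hgcd hgcd',
      fun h => LonelyRunner.unimodularEquiv_of_volumeVector_eq hU hU' hgcd h c c'⟩
  · rintro _ hv _ ⟨U, hU, rfl, -, c, rfl⟩
    have h35 := LonelyRunner.MeetsCube.mem_coveringDilations hU
      (LonelyRunner.meetsCube_of_mem hv) c
    have h := LonelyRunner.isLeast_coveringRadius three_ne_zero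
      (LonelyRunner.isCompact_zonotope c fun i => LonelyRunner.toReal (U i)) ⟨_, h35⟩
    exact ⟨h, h.2 h35⟩
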